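/- **Conventions.** A *closed curve* is a set $\Gamma\subset\mathbb R^2$ that is the image of a periodic map $\gamma:\mathbb R\to\mathbb R^2$ of class $C^3$ with $\gamma'(t)\neq 0$ for all $t$. A point $p$ of a set $X$ (in the plane) is *simple* if some open set containing $p$ meets $X$ in a set homeomorphic to $\mathbb R$ or to a half-open interval; otherwise it is a *point of self-intersection*. $\Gamma$ is *simple* if all its points are. A curve $\Gamma$ is *oriented*: each simple point $p$ carries the set (with one or two elements) of unit tangent vectors $\gamma'(t)/|\gamma'(t)|$ at the parameters $t$ with $\gamma(t)=p$. A *parameterization* of the oriented closed curve $\Gamma$ is any periodic regular $C^3$ map with image $\Gamma$ that induces the orientation of $\Gamma$. Two oriented curves are *congruent* if some $g\in SE(2)$ carries one to the other, as sets and with orientations. For a parameterization $\gamma$ put $\kappa=\det(\gamma',\gamma'')/|\gamma'|^3$, $\dot\kappa=\kappa'/|\gamma'|$ and $\sigma_\gamma=(\kappa,\dot\kappa):\mathbb R\to\mathbb R^2$. The *signature* of $\Gamma$ is the set $S$ of all values of $\sigma_\gamma$. A *vertex* of $\Gamma$ is a point of $\Gamma$ at which $\dot\kappa$ vanishes; $\Gamma$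 is *non-degenerate* if its vertices are isolated. Let $Q$ be the set of points of self-intersection of $S$. The *signature quiver* $\Delta_S$ has vertex set $Q$; its edges are the connected components of $S\setminus Q$, where a component $e$ is an edge from $p$ to $q$ if it is traversed once from $p$ to $q$ in the orientation of a phase portrait: there are a $C^1$ function $f$ and $a<b$ such that $s\mapsto(f(s),f'(s))$ maps $(a,b)$ bijectively onto $e$ and takes $a$ to $p$ and $b$ to $q$. Two closed paths on $\Delta_S$ are *equivalent* if they agree up to a cyclic permutation of their edges. Let $\gamma$ be a parameterization with minimal period $L$, let $\sigma_\gamma(c_0)\in Q$ and let $c_0<c_1<\dots<c_k=c_0+L$ be the points of $[c_0,c_0+L]\cap\sigma_\gamma^{-1}(Q)$; then $\gamma$ *induces* the closed path with successive edges $\sigma_\gamma((c_{i-1},c_i))$, $i=1,\dots,k$, starting at the vertex $\sigma_\gamma(c_0)$. **Theorem.** Let $\Gamma_1$ and $\Gamma_2$ be oriented closed non-degenerate curves with the same signature $S$, and assume that $S$ has at least one, but only finitely many points of self-intersection. 1. If there exist parameterizations of $\Gamma_1$ and $\Gamma_2$ that induce equivalent closed paths on $\Delta_S$, then $\Gamma_1$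 and $\Gamma_2$ are congruent. 2. If $\Gamma_1$ and $\Gamma_2$ are simple, the converse holds: if they are congruent, then there exist parameterizations of $\Gamma_1$ and $\Gamma_2$ that induce equivalent closed paths on $\Delta_S$; moreover, all parameterizations $\gamma_1$ of $\Gamma_1$ and $\gamma_2$ of $\Gamma_2$ that run through their curve exactly once in a minimal period (i.e. $\gamma_i$ is injective on $[0,L_i)$, where $L_i$ is its minimal period) induce equivalent closed paths on $\Delta_S$. -/

import Mathlib

noncomputable section

/-- The Euclidean plane. -/
abbrev Plane : Type := EuclideanSpace ℝ (Fin 2)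

/-! ### Simple points and points of self-intersection -/

/-- A point `p` of `X` is simple if some open set containing `p` meets `X` in a set homeomorphic
to `ℝ` or to a half-open interval. -/
def IsSimplePoint {E : Type*} [TopologicalSpace E] (X : Set E) (p : E) : Prop :=
  p ∈ X ∧ ∃ U : Set E, IsOpen U ∧ p ∈ U ∧
    (Nonempty (↥(U ∩ X) ≃ₜ ℝ) ∨ Nonempty (↥(U ∩ X) ≃ₜ ↥(Set.Ico (0 : ℝ) 1)))

/-- The set of points of self-intersection of `X`. -/
def selfIntersections {E : Type*} [TopologicalSpace E] (X : Set E) : Set E :=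
  {p | p ∈ X ∧ ¬ IsSimplePoint X p}

/-! ### Parameterizations, curvature, signature map -/

/-- A regular `C³` periodic parameterization of a closed planar curve. -/
structure IsClosedRegular (γ : ℝ → Plane) : Prop where
  contDiff : ContDiff ℝ 3 γ
  regular : ∀ t, deriv γ t ≠ 0
  periodic : ∃ T : ℝ, 0 < T ∧ Function.Periodic γ T

/-- `L` is the minimal (positive) period of `γ`. -/
def IsMinimalPeriod (γ : ℝ → Plane) (L : ℝ) : Prop :=
  IsLeast {T : ℝ | 0 < T ∧ Function.Periodic γ T} L

/-- `γ` runs through its image exactly once during a minimal period. -/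
def TraversesOnce (γ : ℝ → Plane) : Prop :=
  ∃ L : ℝ, IsMinimalPeriod γ L ∧ Set.InjOn γ (Set.Ico 0 L)

/-- The determinant of two plane vectors. -/
def planeDet (u v : Plane) : ℝ := u 0 * v 1 - u 1 * v 0

/-- The signed Euclidean curvature `det(γ', γ'') / |γ'|³`. -/
def curvature (γ : ℝ → Plane) (t : ℝ) : ℝ :=
  planeDet (deriv γ t) (deriv (deriv γ) t) / ‖deriv γ t‖ ^ 3

/-- The derivative of the curvature with respect to arc length, `(1 / |γ'|) dκ/dt`. -/
def curvatureDot (γ : ℝ → Plane) (t : ℝ) : ℝ :=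
  deriv (curvature γ) t / ‖deriv γ t‖

/-- The parameterized signature map `σ_γ = (κ, κ̇)`. -/
def sigMap (γ : ℝ → Plane) (t : ℝ) : ℝ × ℝ := (curvature γ t, curvatureDot γ t)

/-! ### Oriented closed curves -/

/-- The orientation that `γ` induces on its image: the set of all pairs `(p, u)` where `p` is a
simple point of the image and `u` is the unit tangent vector of `γ` at some parameter at which `γ`
passes through `p`. (Over a simple point with double orientation there are two such `u`.) -/
def inducedOrientation (γ : ℝ → Plane) : Set (Plane × Plane) :=
  {x | IsSimplePoint (Set.range γ) x.1 ∧
    ∃ t, γ t = x.1 ∧ ‖deriv γ t‖⁻¹ • deriv γ t = x.2}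

/-- An oriented closed `C³` immersed planar curve: a set of points, with an orientation (single or
double) at each of its simple points, both of which come from a regular `C³` periodic
parameterization. The parameterization itself is not part of the data. -/
structure OrientedClosedCurve where
  carrier : Set Plane
  orientation : Set (Plane × Plane)
  exists_param : ∃ γ : ℝ → Plane, IsClosedRegular γ ∧
    Set.range γ = carrier ∧ inducedOrientation γ = orientation

namespace OrientedClosedCurve

/-- `γ` is a (regular `C³`, periodic) parameterization of the oriented closed curve `Γ`. -/
structure IsParam (Γ : OrientedClosedCurve) (γ : ℝ → Plane) : Prop where
  closedRegular : IsClosedRegular γ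
  range_eq : Set.range γ = Γ.carrier
  orientation_eq : inducedOrientation γ = Γ.orientation

/-- All points of the curve are simple. -/
def IsSimple (Γ : OrientedClosedCurve) : Prop := ∀ p ∈ Γ.carrier, IsSimplePoint Γ.carrier p

/-- The signature of `Γ`: the image of the signature map. -/
def signature (Γ : OrientedClosedCurve) : Set (ℝ × ℝ) :=
  {z | ∃ γ, Γ.IsParam γ ∧ ∃ t, sigMap γ t = z}

/-- The vertices of the curve: the points at which (a value of) `κ̇` vanishes. -/
def curveVertices (Γ : OrientedClosedCurve) : Set Plane :=
  {p | ∃ γ, Γ.IsParam γ ∧ ∃ t, γ t = p ∧ curvatureDot γ t = 0}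

/-- A curve is non-degenerate if its vertices are isolated. -/
def NonDegenerate (Γ : OrientedClosedCurve) : Prop :=
  ∀ p ∈ Γ.curveVertices, ∃ U : Set Plane, IsOpen U ∧ U ∩ Γ.curveVertices = {p}

/-- Congruence of oriented curves: some `p ↦ A p + v` with `A ∈ SO(2)` carries the first curve to
the second one, as sets and with orientations. -/
def Congruent (Γ₁ Γ₂ : OrientedClosedCurve) : Prop :=
  ∃ A ∈ Matrix.specialOrthogonalGroup (Fin 2) ℝ, ∃ v : Plane,
    Γ₂.carrier = (fun p => Matrix.toEuclideanLin A p + v) '' Γ₁.carrier ∧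
    Γ₂.orientation =
      (fun x : Plane × Plane => (Matrix.toEuclideanLin A x.1 + v, Matrix.toEuclideanLin A x.2)) ''
        Γ₁.orientation

end OrientedClosedCurve

/-! ### The signature quiver -/

/-- The vertices of the quiver `Δ_S`: the points of self-intersection of `S`. -/
def QuiverVertex (S : Set (ℝ × ℝ)) : Type := {q : ℝ × ℝ // q ∈ selfIntersections S}

/-- The segment `e` runs from `p` to `q` in the orientation of a phase portrait: it is traversed
once, from `p` to `q`, by a map of the form `s ↦ (f s, f' s)`. -/
def RunsFromTo (p : ℝ × ℝ) (e : Set (ℝ × ℝ)) (q : ℝ × ℝ) : Prop :=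
  ∃ (f : ℝ → ℝ) (a b : ℝ), ContDiff ℝ 1 f ∧ a < b ∧
    Set.InjOn (fun s => (f s, deriv f s)) (Set.Ioo a b) ∧
    (fun s => (f s, deriv f s)) '' Set.Ioo a b = e ∧
    (f a, deriv f a) = p ∧ (f b, deriv f b) = q

/-- The edges of `Δ_S` from `p` to `q`: the connected components of `S` minus its points of
self-intersection that run from `p` to `q`. -/
@[ext]
structure QuiverEdge (S : Set (ℝ × ℝ)) (p q : QuiverVertex S) where
  segment : Set (ℝ × ℝ)
  isComponent : ∃ z ∈ S \ selfIntersections S,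
    segment = connectedComponentIn (S \ selfIntersections S) z
  runs : RunsFromTo p.1 segment q.1

/-- The quiver `Δ_S`. -/
instance signatureQuiver (S : Set (ℝ × ℝ)) : Quiver (QuiverVertex S) where
  Hom p q := QuiverEdge S p q

/-- The sequence of segments that correspond to the successive edges of a path in `Δ_S`. -/
def pathSegments {S : Set (ℝ × ℝ)} {p : QuiverVertex S} :
    {q : QuiverVertex S} → Quiver.Path p q → List (Set (ℝ × ℝ))
  | _, Quiver.Path.nil => []
  | _, Quiver.Path.cons W e => pathSegments W ++ [QuiverEdge.segment e]

/-- Two closed paths are equivalent if they agree up to a cyclic permutation of their edges. -/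
def ClosedPathEquiv {S : Set (ℝ × ℝ)} {p q : QuiverVertex S}
    (W : Quiver.Path p p) (W' : Quiver.Path q q) : Prop :=
  ∃ (A : Quiver.Path p q) (B : Quiver.Path q p), W = A.comp B ∧ W' = B.comp A

/-- The parameterization `γ` induces the closed path `W` on `Δ_S`: starting at a parameter `c 0`
that `σ_γ` maps to a point of self-intersection of `S`, the parameters in one minimal period that
are mapped to points of self-intersection are `c 0 < c 1 < ⋯ < c k = c 0 + L`, and the successive
edges of `W` are the images under `σ_γ` of the intervals between them. -/
def InducesPath {S : Set (ℝ × ℝ)} (γ : ℝ → Plane) {p : QuiverVertex S}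
    (W : Quiver.Path p p) : Prop :=
  ∃ (L : ℝ) (k : ℕ) (c : Fin (k + 1) → ℝ),
    IsMinimalPeriod γ L ∧ StrictMono c ∧ c (Fin.last k) = c 0 + L ∧
    Set.range c = Set.Icc (c 0) (c 0 + L) ∩ sigMap γ ⁻¹' selfIntersections S ∧
    sigMap γ (c 0) = p.1 ∧
    pathSegments W =
      List.ofFn (fun i : Fin k => sigMap γ '' Set.Ioo (c i.castSucc) (c i.succ))

/-- `γ₁` and `γ₂` induce equivalent closed paths on `Δ_S`. -/
def InduceEquivalentPaths (S : Set (ℝ × ℝ)) (γ₁ γ₂ : ℝ → Plane) : Prop :=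
  ∃ (p q : QuiverVertex S) (W₁ : Quiver.Path p p) (W₂ : Quiver.Path q q),
    InducesPath γ₁ W₁ ∧ InducesPath γ₂ W₂ ∧ ClosedPathEquiv W₁ W₂

end

open Set Filter Topology

/-! ### Local structure at simple points -/

/-! A plane curve is determined up to a rigid motion by its curvature as a function of arc length,
and in arc length the signature map is the phase curve `(f, f')` of that function. The question is
how much of `f` can be read off its phase curve. If two phase curves `(f, f')` and `(g, g')` in `S`
meet at a simple point, one lifts locally through the other: `f ∘ h = g` and `f' ∘ h = g'`. The
chain rule gives `h' = 1` where `g' ≠ 0`. Non-degeneracy makes the other parameters isolated, so `h`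
is a translation (`eventually_phase_eq`). By an open-closed argument an edge of the quiver
determines `f` along it up to translation, including its length (`phase_eq_on_arc`). Only at points
of self-intersection is there a choice of continuation, and the closed path records these choices.
Concatenating edges gives equality over a period (`Follows.eq_translate`), and the Frenet equations
give congruence. For the converse, the same lifting with unit tangents in place of phase points
shows that arc length parameterizations of a simple curve differ by a translation
(`IsSimple.exists_translate`). An induced path exists because the parameters over the finite set of
self-intersections are finite in number in a period, and each arc between them fills a whole
component (`exists_edge`). -/

lemma IsSimplePoint.exists_coordinate {E : Type*} [TopologicalSpace E] {X : Set E} {p : E}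
    (hp : IsSimplePoint X p) :
    ∃ U : Set E, IsOpen U ∧ p ∈ U ∧ ∃ ψ : E → ℝ, ContinuousOn ψ (U ∩ X) ∧ InjOn ψ (U ∩ X) := by
  classical
  obtain ⟨-, U, hU, hpU, h⟩ := hp
  -- Both local models embed in `ℝ`; one injective coordinate serves both cases.
  have key : ∃ φ : ↥(U ∩ X) → ℝ, Continuous φ ∧ Function.Injective φ := by
    rcases h with ⟨⟨e⟩⟩ | ⟨⟨e⟩⟩
    · exact ⟨e, e.continuous, e.injective⟩
    · exact ⟨fun z => (e z : ℝ), continuous_subtype_val.comp e.continuous,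
        Subtype.val_injective.comp e.injective⟩
  obtain ⟨φ, hφ, hinj⟩ := key
  refine ⟨U, hU, hpU, fun z => if h : z ∈ U ∩ X then φ ⟨z, h⟩ else 0, ?_, ?_⟩
  · rw [continuousOn_iff_continuous_domRestrict]
    convert hφ using 1
    ext z
    simp only [Set.domRestrict_apply]
    exact dif_pos z.2
  · intro x hx y hy hxy
    simp only [dif_pos hx, dif_pos hy] at hxy
    exact congrArg Subtype.val (hinj hxy)

lemma IsSimplePoint.eventually {E : Type*} [TopologicalSpace E] {X : Set E} {p : E}
    (hp : IsSimplePoint X p) : ∀ᶠ z in 𝓝[X] p, IsSimplePoint X z := by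
  obtain ⟨-, U, hU, hpU, h⟩ := hp
  filter_upwards [mem_nhdsWithin_of_mem_nhds (hU.mem_nhds hpU), self_mem_nhdsWithin] with z hz hzX
  exact ⟨hzX, U, hU, hz, h⟩

/-- Around a simple point, a continuous curve in `X` that is injective covers `X`. -/
lemma IsSimplePoint.image_Ioo_mem_nhdsWithin {E : Type*} [TopologicalSpace E] {X : Set E}
    {F : ℝ → E} {t ε : ℝ} (hp : IsSimplePoint X (F t)) (hF : Continuous F) (hFX : ∀ x, F x ∈ X)
    (hε : 0 < ε) (hinj : InjOn F (Ioo (t - ε) (t + ε))) :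
    F '' Ioo (t - ε) (t + ε) ∈ 𝓝[X] (F t) := by
  obtain ⟨U, hU, hpU, ψ, hψ, hψi⟩ := hp.exists_coordinate
  obtain ⟨η, hη, hball⟩ := Metric.mem_nhds_iff.1 (hF.continuousAt.preimage_mem_nhds
    (hU.mem_nhds hpU))
  obtain ⟨δ, hδ, hδε, hδη⟩ : ∃ δ > 0, δ < ε ∧ δ < η :=
    ⟨min ε η / 2, by positivity, by
      have := min_le_left ε η; have : 0 < min ε η := by positivity
      linarith, by
      have := min_le_right ε η; have : 0 < min ε η := by positivity
      linarith⟩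
  have hsub : Icc (t - δ) (t + δ) ⊆ Ioo (t - ε) (t + ε) := fun x hx =>
    ⟨by linarith [hx.1], by linarith [hx.2]⟩
  have hmaps : MapsTo F (Icc (t - δ) (t + δ)) (U ∩ X) := fun x hx => by
    refine ⟨hball ?_, hFX x⟩
    rw [Metric.mem_ball, Real.dist_eq, abs_lt]
    exact ⟨by linarith [hx.1], by linarith [hx.2]⟩
  have hG : ContinuousOn (ψ ∘ F) (Icc (t - δ) (t + δ)) := hψ.comp hF.continuousOn hmaps
  have hGi : InjOn (ψ ∘ F) (Icc (t - δ) (t + δ)) := hψi.comp (hinj.mono hsub) hmaps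
  have hle : t - δ ≤ t + δ := by linarith
  have hl : t - δ ∈ Icc (t - δ) (t + δ) := ⟨le_rfl, hle⟩
  have hr : t + δ ∈ Icc (t - δ) (t + δ) := ⟨hle, le_rfl⟩
  have hm : t ∈ Icc (t - δ) (t + δ) := ⟨by linarith, by linarith⟩
  -- A continuous injective real function on an interval is strictly monotone, so its image
  -- surrounds the value at the interior point `t`. Injectivity of `ψ` then pulls this back to `X`.
  have himg : (ψ ∘ F) '' Icc (t - δ) (t + δ) ∈ 𝓝 (ψ (F t)) := by
    rcases hG.strictMonoOn_of_injOn_Icc' hle hGi with h | h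
    · exact mem_of_superset (Icc_mem_nhds (h hl hm (by linarith)) (h hm hr (by linarith)))
        (intermediate_value_Icc hle hG)
    · exact mem_of_superset (Icc_mem_nhds (h hm hr (by linarith)) (h hl hm (by linarith)))
        (intermediate_value_Icc' hle hG)
  have hUX : U ∩ X ∈ 𝓝[X] (F t) :=
    inter_mem (mem_nhdsWithin_of_mem_nhds (hU.mem_nhds hpU)) self_mem_nhdsWithin
  have hψt : Tendsto ψ (𝓝[X] (F t)) (𝓝 (ψ (F t))) := by
    have := hψ (F t) ⟨hpU, hFX t⟩
    rwa [ContinuousWithinAt, nhdsWithin_inter_of_mem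
      (mem_nhdsWithin_of_mem_nhds (hU.mem_nhds hpU))] at this
  filter_upwards [hψt himg, hUX] with z ⟨x, hx, hxz⟩ hz
  exact ⟨x, hsub hx, hψi (hmaps hx) hz hxz⟩

/-- Near a simple point of `X`, a curve `G` in `X` lifts through an injective curve `F` in `X`. -/
lemma IsSimplePoint.exists_lift {E : Type*} [TopologicalSpace E] {X : Set E} {F G : ℝ → E}
    {s r ε : ℝ} (hp : IsSimplePoint X (F s)) (hF : Continuous F) (hG : Continuous G)
    (hFX : ∀ x, F x ∈ X) (hGX : ∀ x, G x ∈ X) (hε : 0 < ε)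
    (hinj : InjOn F (Ioo (s - ε) (s + ε))) (heq : F s = G r) :
    ∃ (h : ℝ → ℝ) (δ : ℝ), 0 < δ ∧ ContinuousOn h (Ioo (r - δ) (r + δ)) ∧ h r = s ∧
      ∀ x ∈ Ioo (r - δ) (r + δ), h x ∈ Ioo (s - ε) (s + ε) ∧ F (h x) = G x := by
  have hGt : Tendsto G (𝓝 r) (𝓝[X] (F s)) := by
    rw [heq]
    exact tendsto_nhdsWithin_iff.2 ⟨hG.continuousAt, .of_forall hGX⟩
  have hev : ∀ᶠ x in 𝓝 r, IsSimplePoint X (G x) ∧ G x ∈ F '' Ioo (s - ε) (s + ε) :=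
    (hGt.eventually hp.eventually).and
      (hGt.eventually (hp.image_Ioo_mem_nhdsWithin hF hFX hε hinj))
  obtain ⟨δ, hδ, hball⟩ := Metric.eventually_nhds_iff_ball.1 hev
  rw [Real.ball_eq_Ioo] at hball
  set h : ℝ → ℝ := fun x => Function.invFunOn F (Ioo (s - ε) (s + ε)) (G x)
  have hspec : ∀ x ∈ Ioo (r - δ) (r + δ), h x ∈ Ioo (s - ε) (s + ε) ∧ F (h x) = G x := by
    intro x hx
    obtain ⟨y, hy, hyx⟩ := (hball x hx).2
    exact ⟨Function.invFunOn_mem ⟨y, hy, hyx⟩, Function.invFunOn_eq ⟨y, hy, hyx⟩⟩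
  refine ⟨h, δ, hδ, ?_, ?_, hspec⟩
  · intro x hx
    refine ContinuousAt.continuousWithinAt ?_
    obtain ⟨hhx, hFx⟩ := hspec x hx
    rw [ContinuousAt, Metric.tendsto_nhds]
    intro η hη
    obtain ⟨ρ, hρ, hρη, hρs⟩ : ∃ ρ > 0, ρ ≤ η ∧
        Ioo (h x - ρ) (h x + ρ) ⊆ Ioo (s - ε) (s + ε) := by
      obtain ⟨ρ, hρ, hb⟩ := Metric.isOpen_iff.1 (isOpen_Ioo (a := s - ε) (b := s + ε)) _ hhx
      rw [Real.ball_eq_Ioo] at hb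
      refine ⟨min ρ η, by positivity, min_le_right _ _, subset_trans (Ioo_subset_Ioo ?_ ?_) hb⟩
      · linarith [min_le_left ρ η]
      · linarith [min_le_left ρ η]
    have hs : IsSimplePoint X (F (h x)) := by rw [hFx]; exact (hball x hx).1
    -- Continuity of `h`: covering also holds at the smaller scale `ρ` around `h x`, and injectivity
    -- of `F` forces the preimage found there to be `h x'`.
    have hmem := hs.image_Ioo_mem_nhdsWithin hF hFX hρ (hinj.mono hρs)
    have hGx : Tendsto G (𝓝 x) (𝓝[X] (F (h x))) := by
      rw [hFx]
      exact tendsto_nhdsWithin_iff.2 ⟨hG.continuousAt, .of_forall hGX⟩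
    filter_upwards [hGx.eventually hmem, Ioo_mem_nhds hx.1 hx.2] with x' ⟨y, hy, hyx⟩ hx'
    have : y = h x' := hinj (hρs hy) (hspec x' hx').1 (hyx.trans (hspec x' hx').2.symm)
    rw [← this, Real.dist_eq, abs_lt]
    exact ⟨by linarith [hy.1], by linarith [hy.2]⟩
  · have hr : r ∈ Ioo (r - δ) (r + δ) := ⟨by linarith, by linarith⟩
    exact hinj (hspec r hr).1 ⟨by linarith, by linarith⟩ ((hspec r hr).2.trans heq.symm)

/-- The lift `h` is only known to be continuous; near `x` it equals the local inverse of `f`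
composed with `g`, hence is differentiable. -/
lemma HasStrictDerivAt.hasDerivAt_of_comp_eventuallyEq {f g h : ℝ → ℝ} {x a b : ℝ}
    (hf : HasStrictDerivAt f a (h x)) (ha : a ≠ 0) (hg : HasDerivAt g b x)
    (hh : ContinuousAt h x) (heq : ∀ᶠ y in 𝓝 x, f (h y) = g y) : HasDerivAt h (a⁻¹ * b) x := by
  have hinv := (hf.to_localInverse ha).hasDerivAt
  rw [heq.self_of_nhds] at hinv
  refine (hinv.comp x hg).congr_of_eventuallyEq ?_
  filter_upwards [hh.eventually (hf.eventually_left_inverse ha), heq] with y hy hy'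
  rw [Function.comp_apply, ← hy', hy]

/-- The center `r` may be a critical point, where nothing is known about `h'`. The mean value
theorem on an interval ending at `r` needs only continuity there. -/
lemma eq_add_of_hasDerivAt_one {h : ℝ → ℝ} {r δ : ℝ} (hc : ContinuousOn h (Ioo (r - δ) (r + δ)))
    (hd : ∀ x ∈ Ioo (r - δ) (r + δ), x ≠ r → HasDerivAt h 1 x) {x : ℝ}
    (hx : x ∈ Ioo (r - δ) (r + δ)) : h x = h r + (x - r) := by
  rcases lt_trichotomy x r with hlt | rfl | hlt
  · have hsub : Icc x r ⊆ Ioo (r - δ) (r + δ) := fun y hy =>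
      ⟨by linarith [hx.1, hy.1], by linarith [hx.1, hy.2]⟩
    obtain ⟨c, hc, h1⟩ := exists_hasDerivAt_eq_slope h (fun _ => 1) hlt (hc.mono hsub)
      (fun y hy => hd y (hsub ⟨hy.1.le, hy.2.le⟩) hy.2.ne)
    rw [eq_div_iff (by linarith)] at h1
    linarith
  · simp
  · have hsub : Icc r x ⊆ Ioo (r - δ) (r + δ) := fun y hy =>
      ⟨by linarith [hx.2, hy.1], by linarith [hx.2, hy.2]⟩
    obtain ⟨c, hc, h1⟩ := exists_hasDerivAt_eq_slope h (fun _ => 1) hlt (hc.mono hsub)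
      (fun y hy => hd y (hsub ⟨hy.1.le, hy.2.le⟩) hy.1.ne')
    rw [eq_div_iff (by linarith)] at h1
    linarith

/-! ### Phase curves -/

/-- The phase curve of a real function. -/
noncomputable def phase (f : ℝ → ℝ) (s : ℝ) : ℝ × ℝ := (f s, deriv f s)

lemma phase_translate {f g : ℝ → ℝ} {τ : ℝ} (h : ∀ s, f (s + τ) = g s) (s : ℝ) :
    phase f (s + τ) = phase g s := by
  rw [phase, phase, h, ← deriv_comp_add_const]
  exact congrArg (fun d => (g s, d)) (congrArg (fun f => deriv f s) (funext h))

/-- `f` is `C¹` and the zeros of its derivative are isolated. -/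
structure HasIsolatedCriticalPoints (f : ℝ → ℝ) : Prop where
  contDiff : ContDiff ℝ 1 f
  isolated : ∀ t, ∀ᶠ x in 𝓝[≠] t, deriv f x ≠ 0

namespace HasIsolatedCriticalPoints

variable {f g : ℝ → ℝ}

lemma continuous_deriv (hf : HasIsolatedCriticalPoints f) : Continuous (deriv f) :=
  hf.contDiff.continuous_deriv le_rfl

lemma continuous_phase (hf : HasIsolatedCriticalPoints f) : Continuous (phase f) :=
  hf.contDiff.continuous.prodMk hf.continuous_deriv

lemma hasDerivAt (hf : HasIsolatedCriticalPoints f) (x : ℝ) : HasDerivAt f (deriv f x) x :=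
  (hf.contDiff.differentiable one_ne_zero x).hasDerivAt

/-- If `f x = f y` with `x < y` near `t`, Rolle's theorem puts the only possible critical point `t`
between them. Since `f'` keeps its sign on each side of `t` and the increments cancel, `f' x` and
`f' y` have opposite signs, so the phase points differ. -/
lemma exists_injOn_phase (hf : HasIsolatedCriticalPoints f) (t : ℝ) :
    ∃ ε > 0, InjOn (phase f) (Ioo (t - ε) (t + ε)) := by
  obtain ⟨ε, hε, hball⟩ := Metric.eventually_nhds_iff_ball.1
    (eventually_nhdsWithin_iff.1 (hf.isolated t))
  rw [Real.ball_eq_Ioo] at hball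
  have hsign : ∀ a b, a ≤ b → (∀ x ∈ Icc a b, deriv f x ≠ 0) → 0 < deriv f a * deriv f b := by
    intro a b hab hne
    by_contra hcon
    have hab0 : deriv f a * deriv f b ≤ 0 := not_lt.1 hcon
    have h0 : (0 : ℝ) ∈ deriv f '' Icc a b := by
      rcases mul_nonpos_iff.1 hab0 with h | h
      · exact intermediate_value_Icc' hab hf.continuous_deriv.continuousOn ⟨h.2, h.1⟩
      · exact intermediate_value_Icc hab hf.continuous_deriv.continuousOn ⟨h.1, h.2⟩
    obtain ⟨x, hx, hx0⟩ := h0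
    exact hne x hx hx0
  have key : ∀ x ∈ Ioo (t - ε) (t + ε), ∀ y ∈ Ioo (t - ε) (t + ε), x < y →
      phase f x ≠ phase f y := by
    intro x hx y hy hxy heq
    have h1 : f x = f y := congrArg Prod.fst heq
    have h2 : deriv f x = deriv f y := congrArg Prod.snd heq
    have mvt : ∀ a b, a < b → ∃ c ∈ Ioo a b, deriv f c * (b - a) = f b - f a := by
      intro a b hab
      obtain ⟨c, hc, h⟩ := exists_hasDerivAt_eq_slope f (deriv f) hab
        hf.contDiff.continuous.continuousOn (fun y _ => hf.hasDerivAt y)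
      exact ⟨c, hc, by rw [h, div_mul_cancel₀ _ (by linarith)]⟩
    obtain ⟨z, hz, hz0⟩ := mvt x y hxy
    have hzt : z = t := by
      by_contra hne
      refine hball z ⟨by linarith [hx.1, hz.1], by linarith [hy.2, hz.2]⟩ hne ?_
      rw [h1, sub_self] at hz0
      exact (mul_eq_zero.1 hz0).resolve_right (by linarith)
    subst hzt
    obtain ⟨z₁, hz₁, e₁⟩ := mvt x z hz.1
    obtain ⟨z₂, hz₂, e₂⟩ := mvt z y hz.2
    have s₁ := hsign x z₁ hz₁.1.le fun w hw =>
      hball w ⟨by linarith [hx.1, hw.1], by linarith [hw.2, hz₁.2]⟩ (by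
        have := hw.2; have := hz₁.2; intro h; simp only [mem_singleton_iff] at h; linarith)
    have s₂ := hsign z₂ y hz₂.2.le fun w hw =>
      hball w ⟨by linarith [hw.1, hz₂.1], by linarith [hw.2, hy.2]⟩ (by
        have := hw.1; have := hz₂.1; intro h; simp only [mem_singleton_iff] at h; linarith)
    have p₁ : 0 < z - x := by linarith [hz.1]
    have p₂ : 0 < y - z := by linarith [hz.2]
    have q₁ := mul_pos s₁ p₁
    have q₂ := mul_pos s₂ p₂
    rw [← h2] at q₂
    have e : deriv f x * (deriv f z₁ * (z - x)) + deriv f x * (deriv f z₂ * (y - z)) = 0 := by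
      rw [e₁, e₂, h1]; ring
    nlinarith
  refine ⟨ε, hε, fun x hx y hy heq => ?_⟩
  rcases lt_trichotomy x y with h | h | h
  · exact absurd heq (key x hx y hy h)
  · exact h
  · exact absurd heq.symm (key y hy x hx h)

/-- Two phase curves in `S` that meet at a simple point of `S` coincide nearby. -/
lemma eventually_phase_eq {S : Set (ℝ × ℝ)} (hf : HasIsolatedCriticalPoints f)
    (hg : HasIsolatedCriticalPoints g) (hfS : ∀ x, phase f x ∈ S) (hgS : ∀ x, phase g x ∈ S)
    {s r : ℝ} (hp : IsSimplePoint S (phase f s)) (heq : phase f s = phase g r) :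
    ∀ᶠ x in 𝓝 r, phase f (s + (x - r)) = phase g x := by
  obtain ⟨ε, hε, hinj⟩ := hf.exists_injOn_phase s
  obtain ⟨h, δ, hδ, hc, hr, hspec⟩ := hp.exists_lift hf.continuous_phase hg.continuous_phase
    hfS hgS hε hinj heq
  obtain ⟨η, hη, hball⟩ := Metric.eventually_nhds_iff_ball.1
    (eventually_nhdsWithin_iff.1 (hg.isolated r))
  rw [Real.ball_eq_Ioo] at hball
  have hm : 0 < min δ η := by positivity
  have hsub : Ioo (r - min δ η) (r + min δ η) ⊆ Ioo (r - δ) (r + δ) :=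
    Ioo_subset_Ioo (by linarith [min_le_left δ η]) (by linarith [min_le_left δ η])
  have hsub' : Ioo (r - min δ η) (r + min δ η) ⊆ Ioo (r - η) (r + η) :=
    Ioo_subset_Ioo (by linarith [min_le_right δ η]) (by linarith [min_le_right δ η])
  -- Differentiating `f (h x) = g x` gives `f' (h x) * h' x = g' x`, while the second phase
  -- coordinate says `f' (h x) = g' x ≠ 0`.
  have hd : ∀ x ∈ Ioo (r - min δ η) (r + min δ η), x ≠ r → HasDerivAt h 1 x := by
    intro x hx hxr
    have hx' := hsub hx
    have hne : deriv g x ≠ 0 := hball x (hsub' hx) hxr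
    have e2 : deriv f (h x) = deriv g x := congrArg Prod.snd (hspec x hx').2
    have hfs : HasStrictDerivAt f (deriv g x) (h x) := by
      rw [← e2]
      exact hf.contDiff.contDiffAt.hasStrictDerivAt one_ne_zero
    have := hfs.hasDerivAt_of_comp_eventuallyEq hne (hg.hasDerivAt x)
      ((hc x hx').continuousAt (Ioo_mem_nhds hx'.1 hx'.2)) (by
        filter_upwards [Ioo_mem_nhds hx'.1 hx'.2] with y hy
        exact congrArg Prod.fst (hspec y hy).2)
    rwa [inv_mul_cancel₀ hne] at this
  filter_upwards [Ioo_mem_nhds (show r - min δ η < r by linarith) (show r < r + min δ η by linarith)]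
    with x hx
  rw [← hr, ← eq_add_of_hasDerivAt_one (hc.mono hsub) hd hx]
  exact (hspec x (hsub hx)).2

/-- Phase curves with a common point on arcs between consecutive points of self-intersection
of `S` coincide on these arcs. -/
lemma phase_eq_on_arc {S : Set (ℝ × ℝ)} (hf : HasIsolatedCriticalPoints f)
    (hg : HasIsolatedCriticalPoints g) (hfS : ∀ x, phase f x ∈ S) (hgS : ∀ x, phase g x ∈ S)
    {a b a' b' s r : ℝ} (hs : s ∈ Ioo a b) (hr : r ∈ Ioo a' b')
    (hfQ : ∀ x ∈ Ioo a b, phase f x ∉ selfIntersections S)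
    (hgQ : ∀ x ∈ Ioo a' b', phase g x ∉ selfIntersections S)
    (ha : phase f a ∈ selfIntersections S) (hb : phase f b ∈ selfIntersections S)
    (ha' : phase g a' ∈ selfIntersections S) (hb' : phase g b' ∈ selfIntersections S)
    (heq : phase f s = phase g r) :
    s - a = r - a' ∧ b - s = b' - r ∧ ∀ x ∈ Icc a b, phase f x = phase g (x - a + a') := by
  set E : Set ℝ := {x | phase f x = phase g (x - s + r)} with hE
  have hEc : IsClosed E := isClosed_eq hf.continuous_phase
    (hg.continuous_phase.comp ((continuous_id.sub continuous_const).add continuous_const))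
  -- Every point of the open arc is simple, so by local uniqueness `E` is open along it; it is also
  -- closed, and the interval is connected.
  have hsub : Ioo a b ⊆ E := by
    have hopen : Ioo a b ∩ E ⊆ interior E := by
      rintro x ⟨hx, hxE⟩
      rw [mem_interior_iff_mem_nhds]
      have hp : IsSimplePoint S (phase f x) := by
        by_contra hn
        exact hfQ x hx ⟨hfS x, hn⟩
      have h := hf.eventually_phase_eq hg hfS hgS hp hxE
      have ht : Tendsto (fun y => y - s + r) (𝓝 x) (𝓝 (x - s + r)) :=
        ((continuous_id.sub continuous_const).add continuous_const).continuousAt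
      filter_upwards [ht.eventually h] with y hy
      rw [show x + (y - s + r - (x - s + r)) = y by ring] at hy
      exact hy
    have hsE : s ∈ E := by simpa [hE] using heq
    refine (isPreconnected_Ioo.subset_of_closure_inter_subset isOpen_interior
      ⟨s, hs, hopen ⟨hs, hsE⟩⟩ ?_).trans interior_subset
    rintro x ⟨hx, hxI⟩
    exact hopen ⟨hxI, closure_minimal interior_subset hEc hx⟩
  have hab : a < b := hs.1.trans hs.2
  have hIcc : Icc a b ⊆ E := by
    rw [← closure_Ioo hab.ne]
    exact closure_minimal hsub hEc
  have hnot : ∀ y, a < y - r + s → y - r + s < b → phase g y ∉ selfIntersections S := by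
    intro y h1 h2
    have := hsub ⟨h1, h2⟩
    rw [hE, mem_ofPred_eq, show y - r + s - s + r = y by ring] at this
    rw [← this]
    exact hfQ _ ⟨h1, h2⟩
  have hEa : phase g (a - s + r) ∈ selfIntersections S := by
    rw [← hIcc (left_mem_Icc.2 hab.le)]; exact ha
  have hEb : phase g (b - s + r) ∈ selfIntersections S := by
    rw [← hIcc (right_mem_Icc.2 hab.le)]; exact hb
  -- If the arcs extended differently far from the common point, the end of the shorter one, a
  -- self-intersection, would fall inside the longer one.
  have hA : s - a = r - a' := by
    rcases lt_trichotomy (s - a) (r - a') with h | h | h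
    · exact absurd hEa (hgQ _ ⟨by linarith, by linarith [hr.2, hs.1]⟩)
    · exact h
    · exact absurd ha' (hnot a' (by linarith) (by linarith [hr.1, hs.2]))
  have hB : b - s = b' - r := by
    rcases lt_trichotomy (b - s) (b' - r) with h | h | h
    · exact absurd hEb (hgQ _ ⟨by linarith [hs.2, hr.1], by linarith⟩)
    · exact h
    · exact absurd hb' (hnot b' (by linarith [hr.2, hs.1]) (by linarith))
  refine ⟨hA, hB, fun x hx => ?_⟩
  have := hIcc hx
  rwa [hE, mem_ofPred_eq, show x - s + r = x - a + a' by linarith] at this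

end HasIsolatedCriticalPoints

/-! ### Arc length -/

lemma HasDerivAt.plane_apply {γ : ℝ → Plane} {v : Plane} {t : ℝ} (h : HasDerivAt γ v t)
    (i : Fin 2) : HasDerivAt (fun x => γ x i) (v i) t :=
  ((EuclideanSpace.proj i : Plane →L[ℝ] ℝ).hasFDerivAt).comp_hasDerivAt t h

lemma plane_ext {u v : Plane} (h₀ : u 0 = v 0) (h₁ : u 1 = v 1) : u = v := by
  ext i
  fin_cases i
  · exact h₀
  · exact h₁

lemma plane_norm_sq (u : Plane) : ‖u‖ ^ 2 = u 0 ^ 2 + u 1 ^ 2 := by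
  rw [EuclideanSpace.norm_sq_eq, Fin.sum_univ_two, Real.norm_eq_abs, Real.norm_eq_abs, sq_abs,
    sq_abs]

/-- The unit tangent vector of `γ`. -/
noncomputable def unitTangent (γ : ℝ → Plane) (t : ℝ) : Plane := ‖deriv γ t‖⁻¹ • deriv γ t

namespace IsClosedRegular

variable {γ : ℝ → Plane}

lemma speed_pos (h : IsClosedRegular γ) (t : ℝ) : 0 < ‖deriv γ t‖ := norm_pos_iff.2 (h.regular t)

lemma contDiff_deriv (h : IsClosedRegular γ) : ContDiff ℝ 2 (deriv γ) :=
  (contDiff_succ_iff_deriv.1 (show ContDiff ℝ (2 + 1) γ from h.contDiff)).2.2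

lemma contDiff_deriv_deriv (h : IsClosedRegular γ) : ContDiff ℝ 1 (deriv (deriv γ)) :=
  (contDiff_succ_iff_deriv.1 (show ContDiff ℝ (1 + 1) (deriv γ) from h.contDiff_deriv)).2.2

lemma hasDerivAt (h : IsClosedRegular γ) (t : ℝ) : HasDerivAt γ (deriv γ t) t :=
  (h.contDiff.differentiable (by norm_num) t).hasDerivAt

lemma hasDerivAt_deriv (h : IsClosedRegular γ) (t : ℝ) :
    HasDerivAt (deriv γ) (deriv (deriv γ) t) t :=
  (h.contDiff_deriv.differentiable (by norm_num) t).hasDerivAt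

lemma contDiff_speed (h : IsClosedRegular γ) : ContDiff ℝ 2 fun t => ‖deriv γ t‖ :=
  h.contDiff_deriv.norm ℝ h.regular

lemma continuous_speed (h : IsClosedRegular γ) : Continuous fun t => ‖deriv γ t‖ :=
  h.contDiff_speed.continuous

lemma contDiff_curvature (h : IsClosedRegular γ) : ContDiff ℝ 1 (curvature γ) := by
  have h1 : ContDiff ℝ 1 (deriv γ) := h.contDiff_deriv.of_le (by norm_num)
  have h2 := h.contDiff_deriv_deriv
  have p : ∀ {f : ℝ → Plane}, ContDiff ℝ 1 f → ∀ i, ContDiff ℝ 1 fun t => f t i :=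
    fun hf i => (EuclideanSpace.proj i : Plane →L[ℝ] ℝ).contDiff.comp hf
  exact (((p h1 0).mul (p h2 1)).sub ((p h1 1).mul (p h2 0))).div
    ((h.contDiff_speed.of_le (by norm_num)).pow 3) fun t => (pow_pos (h.speed_pos t) 3).ne'

lemma continuous_curvatureDot (h : IsClosedRegular γ) : Continuous (curvatureDot γ) :=
  (h.contDiff_curvature.continuous_deriv le_rfl).div h.continuous_speed
    fun t => (h.speed_pos t).ne'

lemma hasDerivAt_integral_speed (h : IsClosedRegular γ) (t : ℝ) :
    HasDerivAt (fun u => ∫ x in (0 : ℝ)..u, ‖deriv γ x‖) ‖deriv γ t‖ t :=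
  intervalIntegral.integral_hasDerivAt_right (h.continuous_speed.intervalIntegrable _ _)
    (h.continuous_speed.stronglyMeasurableAtFilter _ _) h.continuous_speed.continuousAt

lemma periodic_deriv {T : ℝ} (hT : Function.Periodic γ T) : Function.Periodic (deriv γ) T := by
  intro t
  rw [← deriv_comp_add_const]
  exact congrArg (fun f => deriv f t) (funext hT)

lemma integral_speed_add (h : IsClosedRegular γ) {T : ℝ} (hT : Function.Periodic γ T) (t : ℝ) :
    ∫ x in (0 : ℝ)..(t + T), ‖deriv γ x‖ =
      (∫ x in (0 : ℝ)..t, ‖deriv γ x‖) + ∫ x in (0 : ℝ)..T, ‖deriv γ x‖ := by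
  have hp : Function.Periodic (fun x => ‖deriv γ x‖) T := fun x => by
    simp only [periodic_deriv hT x]
  have := hp.intervalIntegral_add_eq t 0
  rw [zero_add] at this
  rw [← this, intervalIntegral.integral_add_adjacent_intervals
    (h.continuous_speed.intervalIntegrable _ _) (h.continuous_speed.intervalIntegrable _ _)]

/-- Each period adds the same positive length, so arc length is unbounded in both directions. -/
lemma surjective_integral_speed (h : IsClosedRegular γ) :
    Function.Surjective (fun u => ∫ x in (0 : ℝ)..u, ‖deriv γ x‖) := by
  obtain ⟨T, hT0, hT⟩ := h.periodic
  set ℓ : ℝ → ℝ := fun u => ∫ x in (0 : ℝ)..u, ‖deriv γ x‖ with hℓ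
  have hcont : Continuous ℓ :=
    continuous_iff_continuousAt.2 fun t => (h.hasDerivAt_integral_speed t).continuousAt
  have hmono : StrictMono ℓ := strictMono_of_hasDerivAt_pos h.hasDerivAt_integral_speed h.speed_pos
  have h0 : ℓ 0 = 0 := by simp [hℓ]
  have hpos : 0 < ℓ T := by rw [← h0]; exact hmono hT0
  have hadd : ∀ t, ℓ (t + T) = ℓ t + ℓ T := h.integral_speed_add hT
  have hup : ∀ n : ℕ, ℓ (n * T) = n * ℓ T := by
    intro n
    induction n with
    | zero => simp [h0]
    | succ n ih => push_cast; rw [add_one_mul, hadd, ih]; ring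
  have hdown : ∀ n : ℕ, ℓ (-(n * T)) = -(n * ℓ T) := by
    intro n
    induction n with
    | zero => simp [h0]
    | succ n ih =>
      have := hadd (-((n + 1 : ℕ) * T))
      rw [show -(((n + 1 : ℕ) : ℝ) * T) + T = -(n * T) by push_cast; ring, ih] at this
      push_cast at this ⊢
      linarith
  intro y
  obtain ⟨n, hn⟩ := exists_nat_gt (|y| / ℓ T)
  rw [div_lt_iff₀ hpos] at hn
  refine mem_range_of_exists_le_of_exists_ge hcont ⟨-(n * T), ?_⟩ ⟨n * T, ?_⟩
  · rw [hdown]; linarith [neg_abs_le y]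
  · rw [hup]; linarith [le_abs_self y]

/-- Arc length along `γ`, measured from the parameter `0`. -/
noncomputable def arc (h : IsClosedRegular γ) : ℝ ≃o ℝ :=
  (strictMono_of_hasDerivAt_pos h.hasDerivAt_integral_speed h.speed_pos).orderIsoOfSurjective _
    h.surjective_integral_speed

lemma hasDerivAt_arc (h : IsClosedRegular γ) (t : ℝ) : HasDerivAt h.arc ‖deriv γ t‖ t :=
  h.hasDerivAt_integral_speed t

lemma arc_add_period (h : IsClosedRegular γ) {T : ℝ} (hT : Function.Periodic γ T) (t : ℝ) :
    h.arc (t + T) = h.arc t + h.arc T :=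
  h.integral_speed_add hT t

lemma arc_zero (h : IsClosedRegular γ) : h.arc 0 = 0 :=
  intervalIntegral.integral_same

lemma arc_symm_add_period (h : IsClosedRegular γ) {T : ℝ} (hT : Function.Periodic γ T) (s : ℝ) :
    h.arc.symm (s + h.arc T) = h.arc.symm s + T := by
  rw [OrderIso.symm_apply_eq, h.arc_add_period hT, OrderIso.apply_symm_apply]

lemma hasDerivAt_arc_symm (h : IsClosedRegular γ) (s : ℝ) :
    HasDerivAt h.arc.symm ‖deriv γ (h.arc.symm s)‖⁻¹ s :=
  HasDerivAt.of_local_left_inverse h.arc.symm.continuous.continuousAt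
    (h.hasDerivAt_arc _) (h.speed_pos _).ne' (.of_forall h.arc.apply_symm_apply)

/-- The reparameterization of `γ` by arc length. -/
noncomputable def arcCurve (h : IsClosedRegular γ) (s : ℝ) : Plane := γ (h.arc.symm s)

/-- The unit tangent vector as a function of arc length. -/
noncomputable def arcTangent (h : IsClosedRegular γ) (s : ℝ) : Plane :=
  unitTangent γ (h.arc.symm s)

/-- The curvature as a function of arc length. -/
noncomputable def arcCurvature (h : IsClosedRegular γ) (s : ℝ) : ℝ :=
  curvature γ (h.arc.symm s)

lemma hasDerivAt_arcCurve (h : IsClosedRegular γ) (s : ℝ) :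
    HasDerivAt h.arcCurve (h.arcTangent s) s :=
  (h.hasDerivAt _).scomp s (h.hasDerivAt_arc_symm s)

lemma continuous_arcCurve (h : IsClosedRegular γ) : Continuous h.arcCurve :=
  continuous_iff_continuousAt.2 fun s => (h.hasDerivAt_arcCurve s).continuousAt

lemma continuous_unitTangent (h : IsClosedRegular γ) : Continuous (unitTangent γ) :=
  (h.continuous_speed.inv₀ fun t => (h.speed_pos t).ne').smul h.contDiff_deriv.continuous

lemma continuous_arcTangent (h : IsClosedRegular γ) : Continuous h.arcTangent :=
  h.continuous_unitTangent.comp h.arc.symm.continuous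

lemma norm_unitTangent (h : IsClosedRegular γ) (t : ℝ) : ‖unitTangent γ t‖ = 1 := by
  rw [unitTangent, norm_smul, norm_inv, norm_norm, inv_mul_cancel₀ (h.speed_pos t).ne']

/-! ### Frenet equations and the curvature as a function of arc length. -/

lemma arcTangent_sq (h : IsClosedRegular γ) (s : ℝ) :
    h.arcTangent s 0 ^ 2 + h.arcTangent s 1 ^ 2 = 1 := by
  rw [← plane_norm_sq, arcTangent, h.norm_unitTangent, one_pow]

/-- Follows by comparing two computations of the derivative of the squared speed. -/
lemma hasDerivAt_speed (h : IsClosedRegular γ) (t : ℝ) :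
    HasDerivAt (fun x => ‖deriv γ x‖)
      ((deriv γ t 0 * deriv (deriv γ) t 0 + deriv γ t 1 * deriv (deriv γ) t 1) / ‖deriv γ t‖) t := by
  have hd := (h.contDiff_speed.differentiable (by norm_num) t).hasDerivAt
  have h1 : HasDerivAt (fun x => ‖deriv γ x‖ ^ 2)
      (2 * (deriv γ t 0 * deriv (deriv γ) t 0 + deriv γ t 1 * deriv (deriv γ) t 1)) t := by
    have e := (((h.hasDerivAt_deriv t).plane_apply 0).pow 2).add
      (((h.hasDerivAt_deriv t).plane_apply 1).pow 2)
    refine (e.congr_of_eventuallyEq (.of_forall fun x => plane_norm_sq _)).congr_deriv ?_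
    simp
    ring
  have h2 := (hd.pow 2).unique h1
  refine hd.congr_deriv ?_
  rw [eq_div_iff (h.speed_pos t).ne']
  simp only [Nat.cast_ofNat, Nat.add_one_sub_one, pow_one] at h2
  linarith

/-- The Frenet equation in coordinates: the unit tangent turns at the rate speed times curvature. -/
lemma hasDerivAt_unitTangent (h : IsClosedRegular γ) (t : ℝ) :
    HasDerivAt (fun x => unitTangent γ x 0)
      (-(‖deriv γ t‖ * curvature γ t * unitTangent γ t 1)) t ∧
    HasDerivAt (fun x => unitTangent γ x 1) (‖deriv γ t‖ * curvature γ t * unitTangent γ t 0) t := by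
  have hv := (h.speed_pos t).ne'
  have hinv := (h.hasDerivAt_speed t).inv hv
  have hsq := plane_norm_sq (deriv γ t)
  constructor
  · refine (hinv.mul ((h.hasDerivAt_deriv t).plane_apply 0)).congr_deriv ?_
    simp only [unitTangent, curvature, planeDet, PiLp.smul_apply, smul_eq_mul, Pi.inv_apply]
    generalize ‖deriv γ t‖ = v at *
    field_simp
    rw [hsq]
    ring
  · refine (hinv.mul ((h.hasDerivAt_deriv t).plane_apply 1)).congr_deriv ?_
    simp only [unitTangent, curvature, planeDet, PiLp.smul_apply, smul_eq_mul, Pi.inv_apply]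
    generalize ‖deriv γ t‖ = v at *
    field_simp
    rw [hsq]
    ring

lemma hasDerivAt_arcTangent_zero (h : IsClosedRegular γ) (s : ℝ) :
    HasDerivAt (fun x => h.arcTangent x 0) (-(h.arcCurvature s * h.arcTangent s 1)) s := by
  refine ((h.hasDerivAt_unitTangent _).1.comp s (h.hasDerivAt_arc_symm s)).congr_deriv ?_
  have := (h.speed_pos (h.arc.symm s)).ne'
  simp only [arcTangent, arcCurvature]
  field_simp

lemma hasDerivAt_arcTangent_one (h : IsClosedRegular γ) (s : ℝ) :
    HasDerivAt (fun x => h.arcTangent x 1) (h.arcCurvature s * h.arcTangent s 0) s := by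
  refine ((h.hasDerivAt_unitTangent _).2.comp s (h.hasDerivAt_arc_symm s)).congr_deriv ?_
  have := (h.speed_pos (h.arc.symm s)).ne'
  simp only [arcTangent, arcCurvature]
  field_simp

lemma hasDerivAt_arcCurvature (h : IsClosedRegular γ) (s : ℝ) :
    HasDerivAt h.arcCurvature (curvatureDot γ (h.arc.symm s)) s :=
  ((h.contDiff_curvature.differentiable one_ne_zero _).hasDerivAt.comp s
    (h.hasDerivAt_arc_symm s)).congr_deriv (by rw [curvatureDot, div_eq_mul_inv])

lemma contDiff_arcCurvature (h : IsClosedRegular γ) : ContDiff ℝ 1 h.arcCurvature := by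
  refine contDiff_one_iff_deriv.2 ⟨fun s => (h.hasDerivAt_arcCurvature s).differentiableAt, ?_⟩
  rw [funext fun s => (h.hasDerivAt_arcCurvature s).deriv]
  exact h.continuous_curvatureDot.comp h.arc.symm.continuous

/-- The bridge from geometry to phase curves: `κ̇` is precisely the derivative of `κ` by arc length.
-/
lemma phase_arcCurvature (h : IsClosedRegular γ) (s : ℝ) :
    phase h.arcCurvature s = sigMap γ (h.arc.symm s) := by
  rw [phase, (h.hasDerivAt_arcCurvature s).deriv]; rfl

lemma phase_arcCurvature_arc (h : IsClosedRegular γ) (t : ℝ) :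
    phase h.arcCurvature (h.arc t) = sigMap γ t := by
  rw [phase_arcCurvature, OrderIso.symm_apply_apply]

lemma periodic_sigMap {T : ℝ} (hT : Function.Periodic γ T) :
    Function.Periodic (sigMap γ) T := by
  have h1 := periodic_deriv hT
  have hk : Function.Periodic (curvature γ) T := fun t => by
    have h2 : Function.Periodic (deriv (deriv γ)) T := fun t => by
      rw [← deriv_comp_add_const]
      exact congrArg (fun f => deriv f t) (funext h1)
    rw [curvature, curvature, h1, h2]
  have hk' : Function.Periodic (deriv (curvature γ)) T := fun t => by
    rw [← deriv_comp_add_const]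
    exact congrArg (fun f => deriv f t) (funext hk)
  intro t
  rw [sigMap, sigMap, curvatureDot, curvatureDot, hk, hk', h1]

lemma periodic_arcCurvature (h : IsClosedRegular γ) {T : ℝ} (hT : Function.Periodic γ T) :
    Function.Periodic h.arcCurvature (h.arc T) := fun s => by
  rw [arcCurvature, h.arc_symm_add_period hT]
  exact congrArg Prod.fst (periodic_sigMap hT _)

end IsClosedRegular

/-! ### Non-degenerate curves and critical points of the curvature. -/

namespace OrientedClosedCurve

/-- On a non-degenerate curve the curvature has isolated critical points. -/
lemma IsParam.hasIsolatedCriticalPoints {Γ : OrientedClosedCurve} {γ : ℝ → Plane}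
    (hγ : Γ.IsParam γ) (hΓ : Γ.NonDegenerate) :
    HasIsolatedCriticalPoints hγ.closedRegular.arcCurvature := by
  have h := hγ.closedRegular
  have key : ∀ t, ∀ᶠ x in 𝓝[≠] t, curvatureDot γ x ≠ 0 := by
    intro t
    by_cases ht : curvatureDot γ t = 0
    · obtain ⟨U, hU, hUV⟩ := hΓ (γ t) ⟨γ, hγ, t, rfl, ht⟩
      have htU : γ t ∈ U := (hUV.symm ▸ mem_singleton (γ t) : γ t ∈ U ∩ _).1
      -- Vertices are isolated as points of the plane. A vertex parameter `x` near `t` would give `γ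
      -- x = γ t`, which regularity excludes for `x ≠ t`.
      filter_upwards [(h.hasDerivAt t).eventually_ne (h.regular t),
        nhdsWithin_le_nhds ((h.hasDerivAt t).continuousAt.preimage_mem_nhds (hU.mem_nhds htU))]
        with x hx hxU hx0
      have : γ x ∈ U ∩ Γ.curveVertices := ⟨hxU, γ, hγ, x, rfl, hx0⟩
      rw [hUV] at this
      exact hx this
    · exact nhdsWithin_le_nhds (h.continuous_curvatureDot.continuousAt.eventually_ne ht)
  refine ⟨h.contDiff_arcCurvature, fun s => ?_⟩
  have ht : Tendsto h.arc.symm (𝓝[≠] s) (𝓝[≠] (h.arc.symm s)) :=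
    h.arc.symm.continuous.continuousAt.continuousWithinAt.tendsto_nhdsWithin
      fun x hx => h.arc.symm.injective.ne hx
  filter_upwards [ht.eventually (key _)] with x hx
  rwa [(h.hasDerivAt_arcCurvature x).deriv]

lemma IsParam.phase_mem_signature {Γ : OrientedClosedCurve} {γ : ℝ → Plane}
    (hγ : Γ.IsParam γ) (s : ℝ) : phase hγ.closedRegular.arcCurvature s ∈ Γ.signature :=
  ⟨γ, hγ, _, (hγ.closedRegular.phase_arcCurvature s).symm⟩

end OrientedClosedCurve

/-! ### Rigid motions -/

lemma toEuclideanLin_plane (A : Matrix (Fin 2) (Fin 2) ℝ) (p : Plane) (i : Fin 2) :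
    Matrix.toEuclideanLin A p i = A i 0 * p 0 + A i 1 * p 1 := by
  simp [Matrix.mulVec, dotProduct, Fin.sum_univ_two]

lemma specialOrthogonalGroup_entries {A : Matrix (Fin 2) (Fin 2) ℝ}
    (hA : A ∈ Matrix.specialOrthogonalGroup (Fin 2) ℝ) :
    A 1 1 = A 0 0 ∧ A 1 0 = -A 0 1 ∧ A 0 0 ^ 2 + A 0 1 ^ 2 = 1 := by
  obtain ⟨hO, hdet⟩ := Matrix.mem_specialOrthogonalGroup_iff.1 hA
  rw [Matrix.mem_orthogonalGroup_iff] at hO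
  rw [Matrix.det_fin_two] at hdet
  have h00 := congrFun (congrFun hO 0) 0
  have h01 := congrFun (congrFun hO 0) 1
  have h11 := congrFun (congrFun hO 1) 1
  simp [Matrix.mul_apply, Fin.sum_univ_two] at h00 h01 h11
  -- Expanded, this is the sum of squared entries minus twice the determinant, that is `2 - 2`.
  have key : (A 1 1 - A 0 0) ^ 2 + (A 1 0 + A 0 1) ^ 2 = 0 := by 
    linear_combination h00 + h11 - 2 * hdet
  refine ⟨?_, ?_, by linear_combination h00⟩
  · nlinarith [sq_nonneg (A 1 1 - A 0 0), sq_nonneg (A 1 0 + A 0 1)]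
  · nlinarith [sq_nonneg (A 1 1 - A 0 0), sq_nonneg (A 1 0 + A 0 1)]

lemma exists_homeomorph_rigid {A : Matrix (Fin 2) (Fin 2) ℝ}
    (hA : A ∈ Matrix.specialOrthogonalGroup (Fin 2) ℝ) (v : Plane) :
    ∃ e : Plane ≃ₜ Plane, ∀ p, e p = Matrix.toEuclideanLin A p + v := by
  obtain ⟨h1, h2, h3⟩ := specialOrthogonalGroup_entries hA
  have hc : ∀ B : Matrix (Fin 2) (Fin 2) ℝ, Continuous (Matrix.toEuclideanLin B) :=
    fun B => LinearMap.continuous_of_finiteDimensional _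
  refine ⟨⟨⟨fun p => Matrix.toEuclideanLin A p + v,
    fun p => Matrix.toEuclideanLin A.transpose (p - v), fun p => ?_, fun p => ?_⟩,
    (hc A).add continuous_const, (hc _).comp (continuous_id.sub continuous_const)⟩, fun p => rfl⟩
  · apply plane_ext <;>
    simp only [toEuclideanLin_plane, PiLp.sub_apply, PiLp.add_apply, Matrix.transpose_apply, h1, h2]
    · linear_combination p 0 * h3
    · linear_combination p 1 * h3
  · apply plane_ext <;>
    simp only [toEuclideanLin_plane, PiLp.sub_apply, PiLp.add_apply, Matrix.transpose_apply, h1, h2]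
    · linear_combination (p 0 - v 0) * h3
    · linear_combination (p 1 - v 1) * h3

lemma IsSimplePoint.image {E : Type*} [TopologicalSpace E] {X : Set E} {p : E}
    (hp : IsSimplePoint X p) (e : E ≃ₜ E) : IsSimplePoint (e '' X) (e p) := by
  obtain ⟨hpX, U, hU, hpU, h⟩ := hp
  refine ⟨mem_image_of_mem e hpX, e '' U, e.isOpenMap U hU, mem_image_of_mem e hpU, ?_⟩
  rw [← image_inter e.injective]
  exact h.imp (fun ⟨φ⟩ => ⟨(e.image _).symm.trans φ⟩) fun ⟨φ⟩ => ⟨(e.image _).symm.trans φ⟩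

lemma isSimplePoint_image_iff {E : Type*} [TopologicalSpace E] {X : Set E} {p : E} (e : E ≃ₜ E) :
    IsSimplePoint (e '' X) (e p) ↔ IsSimplePoint X p := by
  refine ⟨fun h => ?_, fun h => h.image e⟩
  have := h.image e.symm
  rwa [← image_comp, e.symm_comp_self, image_id, e.symm_apply_apply] at this

/-- Carrier and orientation depend only on which pairs of point and tangent occur, so the two
matchings of parameters need not be inverse to each other or even continuous. -/
lemma inducedOrientation_eq_image {γ₁ γ₂ : ℝ → Plane} (e : Plane ≃ₜ Plane) (B : Plane → Plane)
    (h₁ : ∀ t, ∃ t', γ₂ t' = e (γ₁ t) ∧ unitTangent γ₂ t' = B (unitTangent γ₁ t))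
    (h₂ : ∀ t', ∃ t, γ₂ t' = e (γ₁ t) ∧ unitTangent γ₂ t' = B (unitTangent γ₁ t)) :
    range γ₂ = e '' range γ₁ ∧
      inducedOrientation γ₂ = (fun x => (e x.1, B x.2)) '' inducedOrientation γ₁ := by
  have hr : range γ₂ = e '' range γ₁ := by
    ext p
    constructor
    · rintro ⟨t', rfl⟩
      obtain ⟨t, ht, -⟩ := h₂ t'
      exact ⟨_, mem_range_self t, ht.symm⟩
    · rintro ⟨_, ⟨t, rfl⟩, rfl⟩
      obtain ⟨t', ht, -⟩ := h₁ t
      exact ⟨t', ht⟩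
  refine ⟨hr, ?_⟩
  ext ⟨p, u⟩
  constructor
  · rintro ⟨hs, t', rfl, rfl⟩
    obtain ⟨t, ht, hu⟩ := h₂ t'
    refine ⟨(γ₁ t, unitTangent γ₁ t), ⟨?_, t, rfl, rfl⟩, Prod.ext ht.symm hu.symm⟩
    rwa [hr, ht, isSimplePoint_image_iff] at hs
  · rintro ⟨⟨q, w⟩, ⟨hs, t, rfl, rfl⟩, hx⟩
    obtain ⟨t', ht, hu⟩ := h₁ t
    obtain ⟨rfl, rfl⟩ := Prod.ext_iff.1 hx
    refine ⟨?_, t', ht, hu⟩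
    rw [hr]
    exact hs.image e

lemma HasDerivAt.eq_of_forall_zero {f : ℝ → ℝ} (hf : ∀ x, HasDerivAt f 0 x) (x y : ℝ) :
    f x = f y :=
  is_const_of_deriv_eq_zero (fun x => (hf x).differentiableAt) (fun x => (hf x).deriv) x y

namespace IsClosedRegular

variable {γ γ₁ γ₂ : ℝ → Plane}

/-- Curves with the same curvature as a function of arc length differ by a rigid motion. -/
lemma exists_rigid_of_arcCurvature_eq (h₁ : IsClosedRegular γ₁) (h₂ : IsClosedRegular γ₂) {τ : ℝ}
    (hκ : ∀ s, h₁.arcCurvature s = h₂.arcCurvature (s + τ)) :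
    ∃ A ∈ Matrix.specialOrthogonalGroup (Fin 2) ℝ, ∃ v : Plane, ∀ s,
      h₂.arcCurve (s + τ) = Matrix.toEuclideanLin A (h₁.arcCurve s) + v ∧
      h₂.arcTangent (s + τ) = Matrix.toEuclideanLin A (h₁.arcTangent s) := by
  have da := h₁.hasDerivAt_arcTangent_zero
  have db := h₁.hasDerivAt_arcTangent_one
  have dp := fun s => (h₂.hasDerivAt_arcTangent_zero (s + τ)).comp_add_const s τ
  have dq := fun s => (h₂.hasDerivAt_arcTangent_one (s + τ)).comp_add_const s τ
  set a : ℝ → ℝ := fun s => h₁.arcTangent s 0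
  set b : ℝ → ℝ := fun s => h₁.arcTangent s 1
  set p : ℝ → ℝ := fun s => h₂.arcTangent (s + τ) 0
  set q : ℝ → ℝ := fun s => h₂.arcTangent (s + τ) 1
  have hab : ∀ s, a s ^ 2 + b s ^ 2 = 1 := h₁.arcTangent_sq
  have hpq : ∀ s, p s ^ 2 + q s ^ 2 = 1 := fun s => h₂.arcTangent_sq (s + τ)
  -- The inner product and the determinant of the two tangents are the cosine and sine of the angle
  -- between them. Equal curvatures make both tangents turn at the same rate, so this angle is
  -- constant and defines the rotation.
  have hc : ∀ s, HasDerivAt (fun s => a s * p s + b s * q s) 0 s := fun s => by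
    refine (((da s).mul (dp s)).add ((db s).mul (dq s))).congr_deriv ?_
    rw [← hκ s]
    ring
  have hd : ∀ s, HasDerivAt (fun s => a s * q s - b s * p s) 0 s := fun s => by
    refine (((da s).mul (dq s)).sub ((db s).mul (dp s))).congr_deriv ?_
    rw [← hκ s]
    ring
  obtain ⟨c, hc⟩ : ∃ c, ∀ s, a s * p s + b s * q s = c :=
    ⟨_, fun s => HasDerivAt.eq_of_forall_zero hc s 0⟩
  obtain ⟨d, hd⟩ : ∃ d, ∀ s, a s * q s - b s * p s = d :=
    ⟨_, fun s => HasDerivAt.eq_of_forall_zero hd s 0⟩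
  have hcd : c ^ 2 + d ^ 2 = 1 := by
    rw [← hc 0, ← hd 0]
    linear_combination (p 0 ^ 2 + q 0 ^ 2) * hab 0 + hpq 0
  have hT : ∀ s, h₂.arcTangent (s + τ) =
      Matrix.toEuclideanLin !![c, -d; d, c] (h₁.arcTangent s) := fun s => by
    apply plane_ext <;> rw [toEuclideanLin_plane] <;> simp only [Matrix.of_apply, Matrix.cons_val]
    · change p s = c * a s + -d * b s
      rw [← hc s, ← hd s]
      linear_combination -p s * hab s
    · change q s = d * a s + c * b s
      rw [← hc s, ← hd s]
      linear_combination -q s * hab s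
  have hpos : ∀ i s, h₂.arcCurve (s + τ) i -
      Matrix.toEuclideanLin !![c, -d; d, c] (h₁.arcCurve s) i =
      h₂.arcCurve (0 + τ) i - Matrix.toEuclideanLin !![c, -d; d, c] (h₁.arcCurve 0) i := by
    intro i s
    refine HasDerivAt.eq_of_forall_zero (f := fun s => h₂.arcCurve (s + τ) i -
      Matrix.toEuclideanLin !![c, -d; d, c] (h₁.arcCurve s) i) (fun s => ?_) s 0
    have e1 := ((h₂.hasDerivAt_arcCurve (s + τ)).plane_apply i).comp_add_const s τ
    have e2 : HasDerivAt (fun s => Matrix.toEuclideanLin !![c, -d; d, c] (h₁.arcCurve s) i)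
        (Matrix.toEuclideanLin !![c, -d; d, c] (h₁.arcTangent s) i) s := by
      simp only [toEuclideanLin_plane]
      exact (((h₁.hasDerivAt_arcCurve s).plane_apply 0).const_mul _).add
        (((h₁.hasDerivAt_arcCurve s).plane_apply 1).const_mul _)
    refine (e1.sub e2).congr_deriv ?_
    rw [hT s, sub_self]
  refine ⟨!![c, -d; d, c], ?_, h₂.arcCurve (0 + τ) -
      Matrix.toEuclideanLin !![c, -d; d, c] (h₁.arcCurve 0), fun s => ⟨?_, hT s⟩⟩
  · rw [Matrix.mem_specialOrthogonalGroup_iff, Matrix.mem_orthogonalGroup_iff]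
    constructor
    · ext i j
      fin_cases i <;> fin_cases j <;>
        simp [Matrix.mul_apply, Fin.sum_univ_two] <;>
        first | linear_combination hcd | ring
    · rw [Matrix.det_fin_two]
      simp
      linear_combination hcd
  · apply plane_ext
    · rw [PiLp.add_apply, PiLp.sub_apply, ← hpos 0 s]; ring
    · rw [PiLp.add_apply, PiLp.sub_apply, ← hpos 1 s]; ring

lemma arcCurve_arc (h : IsClosedRegular γ) (t : ℝ) : h.arcCurve (h.arc t) = γ t := by
  rw [arcCurve, OrderIso.symm_apply_apply]

lemma arcTangent_arc (h : IsClosedRegular γ) (t : ℝ) :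
    h.arcTangent (h.arc t) = unitTangent γ t := by
  rw [arcTangent, OrderIso.symm_apply_apply]

end IsClosedRegular

lemma OrientedClosedCurve.congruent_of_arcCurvature_eq {Γ₁ Γ₂ : OrientedClosedCurve}
    {γ₁ γ₂ : ℝ → Plane} (hγ₁ : Γ₁.IsParam γ₁) (hγ₂ : Γ₂.IsParam γ₂) {τ : ℝ}
    (hκ : ∀ s, hγ₁.closedRegular.arcCurvature s = hγ₂.closedRegular.arcCurvature (s + τ)) :
    Γ₁.Congruent Γ₂ := by
  have h₁ := hγ₁.closedRegular
  have h₂ := hγ₂.closedRegular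
  obtain ⟨A, hA, v, h⟩ := h₁.exists_rigid_of_arcCurvature_eq h₂ hκ
  obtain ⟨e, he⟩ := exists_homeomorph_rigid hA v
  have key : ∀ s, γ₂ (h₂.arc.symm (s + τ)) = e (γ₁ (h₁.arc.symm s)) ∧
      unitTangent γ₂ (h₂.arc.symm (s + τ)) =
        Matrix.toEuclideanLin A (unitTangent γ₁ (h₁.arc.symm s)) := fun s =>
    ⟨(h s).1.trans (he _).symm, (h s).2⟩
  obtain ⟨hr, ho⟩ := inducedOrientation_eq_image e (Matrix.toEuclideanLin A)
    (fun t => ⟨_, by simpa using key (h₁.arc t)⟩)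
    (fun t' => ⟨_, by simpa using key (h₂.arc t' - τ)⟩)
  refine ⟨A, hA, v, ?_, ?_⟩
  · rw [← hγ₂.range_eq, hr, hγ₁.range_eq]
    exact image_congr fun p _ => he p
  · rw [← hγ₂.orientation_eq, ho, hγ₁.orientation_eq]
    exact image_congr fun x _ => by rw [he]

/-! ### Sequences of arcs -/

/-- From `a` to `b`, the curve `σ` meets `Q` at `b` and finitely many intermediate parameters,
and the successive arcs between these are those of the given list. -/
def Follows (Q : Set (ℝ × ℝ)) (σ : ℝ → ℝ × ℝ) : ℝ → List (Set (ℝ × ℝ)) → ℝ → Prop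
  | a, [], b => a = b
  | a, e :: l, b => ∃ c, a < c ∧ σ '' Ioo a c = e ∧ σ c ∈ Q ∧ (∀ x ∈ Ioo a c, σ x ∉ Q) ∧
      Follows Q σ c l b

namespace Follows

variable {Q : Set (ℝ × ℝ)} {σ : ℝ → ℝ × ℝ}

/-- Used both for the passage to arc length and for shifts by a period. -/
lemma comp_orderIso (e : ℝ ≃o ℝ) {l : List (Set (ℝ × ℝ))} {a b : ℝ} (h : Follows Q (σ ∘ e) a l b) :
    Follows Q σ (e a) l (e b) := by
  induction l generalizing a with
  | nil => exact congrArg e h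
  | cons _ l ih =>
    obtain ⟨c, hac, rfl, hc, hx, h⟩ := h
    refine ⟨e c, e.strictMono hac, ?_, hc, fun x hxI => ?_, ih h⟩
    · rw [← e.image_Ioo, image_comp]
    · rw [← e.image_Ioo] at hxI
      obtain ⟨y, hy, rfl⟩ := hxI
      exact hx y hy

lemma add_period {L : ℝ} (hL : Function.Periodic σ L) {l : List (Set (ℝ × ℝ))} {a b : ℝ}
    (h : Follows Q σ a l b) : Follows Q σ (a + L) l (b + L) := by
  have : σ ∘ OrderIso.addRight L = σ := funext hL
  exact comp_orderIso (OrderIso.addRight L) (this.symm ▸ h)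

lemma append_iff {l l' : List (Set (ℝ × ℝ))} {a b : ℝ} :
    Follows Q σ a (l ++ l') b ↔ ∃ m, Follows Q σ a l m ∧ Follows Q σ m l' b := by
  induction l generalizing a with
  | nil => exact ⟨fun h => ⟨a, rfl, h⟩, fun ⟨_, h, h'⟩ => (show a = _ from h) ▸ h'⟩
  | cons e l ih =>
    constructor
    · rintro ⟨c, h1, h2, h3, h4, h⟩
      obtain ⟨m, hm, hm'⟩ := ih.1 h
      exact ⟨m, ⟨c, h1, h2, h3, h4, hm⟩, hm'⟩
    · rintro ⟨m, ⟨c, h1, h2, h3, h4, hm⟩, hm'⟩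
      exact ⟨c, h1, h2, h3, h4, ih.2 ⟨m, hm, hm'⟩⟩

lemma end_mem {l : List (Set (ℝ × ℝ))} {a b : ℝ} (ha : σ a ∈ Q) (h : Follows Q σ a l b) :
    σ b ∈ Q := by
  induction l generalizing a with
  | nil => exact (show a = b from h) ▸ ha
  | cons e l ih => obtain ⟨c, -, -, hc, -, h⟩ := h; exact ih hc h

lemma of_knots {k : ℕ} (c : Fin (k + 1) → ℝ) (hc : StrictMono c) (hQ : ∀ i, σ (c i) ∈ Q)
    (hn : ∀ i : Fin k, ∀ x ∈ Ioo (c i.castSucc) (c i.succ), σ x ∉ Q) :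
    Follows Q σ (c 0) (List.ofFn fun i : Fin k => σ '' Ioo (c i.castSucc) (c i.succ))
      (c (Fin.last k)) := by
  induction k with
  | zero => rfl
  | succ k ih =>
    rw [List.ofFn_succ]
    refine ⟨c 1, hc (by simp), rfl, hQ _, hn 0, ?_⟩
    exact ih (fun i => c i.succ) (fun i j hij => hc (Fin.succ_lt_succ_iff.2 hij))
      (fun i => hQ _) (fun i => hn i.succ)

/-- Two phase curves that follow the same arcs are translates of each other. -/
lemma eq_translate {S : Set (ℝ × ℝ)} {f g : ℝ → ℝ} (hf : HasIsolatedCriticalPoints f)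
    (hg : HasIsolatedCriticalPoints g) (hfS : ∀ x, phase f x ∈ S) (hgS : ∀ x, phase g x ∈ S)
    {l : List (Set (ℝ × ℝ))} {a b a' b' : ℝ}
    (h : Follows (selfIntersections S) (phase f) a l b)
    (h' : Follows (selfIntersections S) (phase g) a' l b')
    (ha : phase f a ∈ selfIntersections S) (ha' : phase g a' ∈ selfIntersections S) :
    b - a = b' - a' ∧ ∀ x ∈ Ico a b, f x = g (x - a + a') := by
  induction l generalizing a a' with
  | nil =>
    -- For an empty list nothing relates `f a` to `g a'`; the half-open interval makes the claim
    -- vacuous.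
    obtain rfl : a = b := h
    obtain rfl : a' = b' := h'
    simp
  | cons e l ih =>
    obtain ⟨c, hac, hce, hcQ, hcn, h⟩ := h
    obtain ⟨c', hac', hce', hcQ', hcn', h'⟩ := h'
    -- The first arcs have the same image, hence a common point, which is all that `phase_eq_on_arc`
    -- needs to match them in full.
    obtain ⟨s, hs⟩ : (Ioo a c).Nonempty := nonempty_Ioo.2 hac
    obtain ⟨r, hr, hrs⟩ : phase f s ∈ phase g '' Ioo a' c' := by
      rw [hce', ← hce]; exact mem_image_of_mem _ hs
    obtain ⟨e1, e2, e3⟩ := hf.phase_eq_on_arc hg hfS hgS hs hr hcn hcn' ha hcQ ha' hcQ' hrs.symm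
    obtain ⟨i1, i2⟩ := ih h h' hcQ hcQ'
    refine ⟨by linarith, fun x hx => ?_⟩
    rcases le_or_gt c x with hcx | hcx
    · rw [i2 x ⟨hcx, hx.2⟩]
      congr 1
      linarith
    · exact congrArg Prod.fst (e3 x ⟨hx.1, hcx.le⟩)

end Follows

lemma pathSegments_comp {S : Set (ℝ × ℝ)} {p q r : QuiverVertex S} (A : Quiver.Path p q)
    (B : Quiver.Path q r) : pathSegments (A.comp B) = pathSegments A ++ pathSegments B := by
  induction B with
  | nil => simp [pathSegments]
  | cons B e ih => simp [pathSegments, ih]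

lemma StrictMono.notMem_of_range_eq {k : ℕ} {c : Fin (k + 1) → ℝ} (hc : StrictMono c) {P : Set ℝ}
    (hr : range c = Icc (c 0) (c (Fin.last k)) ∩ P) (i : Fin k) {x : ℝ}
    (hx : x ∈ Ioo (c i.castSucc) (c i.succ)) : x ∉ P := by
  intro hxP
  obtain ⟨j, rfl⟩ : x ∈ range c := by
    rw [hr]
    exact ⟨⟨(hc.monotone (Fin.zero_le _)).trans hx.1.le,
      hx.2.le.trans (hc.monotone (Fin.le_last _))⟩, hxP⟩
  have h1 := hc.lt_iff_lt.1 hx.1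
  have h2 := hc.lt_iff_lt.1 hx.2
  exact absurd (Fin.castSucc_lt_iff_succ_le.1 h1) (not_le.2 h2)

/-- Translates an induced path into arc length, where `Λ` is the length of one minimal period. -/
lemma IsClosedRegular.follows_of_inducesPath {S : Set (ℝ × ℝ)} {γ : ℝ → Plane}
    (h : IsClosedRegular γ) {p : QuiverVertex S} {W : Quiver.Path p p} (hW : InducesPath γ W) :
    ∃ a Λ : ℝ, 0 < Λ ∧ Function.Periodic h.arcCurvature Λ ∧
      phase h.arcCurvature a ∈ selfIntersections S ∧
      Follows (selfIntersections S) (phase h.arcCurvature) a (pathSegments W) (a + Λ) := by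
  obtain ⟨L, k, c, hL, hc, hlast, hr, -, hseg⟩ := hW
  rw [← hlast] at hr
  have hQ : ∀ i, sigMap γ (c i) ∈ selfIntersections S := fun i =>
    (hr.subset (mem_range_self i)).2
  have hF := Follows.of_knots c hc hQ fun i x hx => hc.notMem_of_range_eq hr i hx
  have hσ : sigMap γ = phase h.arcCurvature ∘ h.arc :=
    funext fun t => (h.phase_arcCurvature_arc t).symm
  refine ⟨h.arc (c 0), h.arc L, ?_, h.periodic_arcCurvature hL.1.2, ?_, ?_⟩
  · rw [← h.arc_zero]; exact h.arc.strictMono hL.1.1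
  · rw [h.phase_arcCurvature_arc]; exact hQ 0
  · rw [← h.arc_add_period hL.1.2, ← hlast, hseg]
    refine Follows.comp_orderIso h.arc ?_
    rw [← hσ]
    exact hF

lemma Function.Periodic.phase {f : ℝ → ℝ} {T : ℝ} (hf : Function.Periodic f T) :
    Function.Periodic (phase f) T := fun s => by
  have : deriv f (s + T) = deriv f s := by
    rw [← deriv_comp_add_const]
    exact congrArg (fun f => deriv f s) (funext hf)
  rw [_root_.phase, hf, this, _root_.phase]

/-- Curves with parameterizations that induce equivalent closed paths are congruent. -/
lemma OrientedClosedCurve.congruent_of_induceEquivalentPaths {Γ₁ Γ₂ : OrientedClosedCurve}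
    {S : Set (ℝ × ℝ)} (hΓ₁ : Γ₁.NonDegenerate) (hΓ₂ : Γ₂.NonDegenerate)
    (hS₁ : Γ₁.signature = S) (hS₂ : Γ₂.signature = S) {γ₁ γ₂ : ℝ → Plane}
    (hγ₁ : Γ₁.IsParam γ₁) (hγ₂ : Γ₂.IsParam γ₂) (h : InduceEquivalentPaths S γ₁ γ₂) :
    Γ₁.Congruent Γ₂ := by
  obtain ⟨p, q, W₁, W₂, hW₁, hW₂, A, B, rfl, rfl⟩ := h
  have hf := hγ₁.hasIsolatedCriticalPoints hΓ₁
  have hg := hγ₂.hasIsolatedCriticalPoints hΓ₂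
  obtain ⟨a, Λ, hΛ, hper, ha, hF⟩ := hγ₁.closedRegular.follows_of_inducesPath hW₁
  obtain ⟨a', Λ', hΛ', hper', ha', hF'⟩ := hγ₂.closedRegular.follows_of_inducesPath hW₂
  rw [pathSegments_comp] at hF hF'
  -- The second curve follows `B` up to `m`, then `A`. Started at `m` instead, it follows `A` and
  -- then `B` of the next period, in the same order as the first curve.
  obtain ⟨m, hB, hA⟩ := Follows.append_iff.1 hF'
  have hF'' := Follows.append_iff.2 ⟨_, hA, hB.add_period hper'.phase⟩
  obtain ⟨hlen, heq⟩ := hF.eq_translate hf hg (fun x => hS₁ ▸ hγ₁.phase_mem_signature x)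
    (fun x => hS₂ ▸ hγ₂.phase_mem_signature x) hF'' ha (hB.end_mem ha')
  obtain rfl : Λ = Λ' := by linarith
  refine congruent_of_arcCurvature_eq hγ₁ hγ₂ (τ := m - a) fun s => ?_
  -- Both curvatures have period `Λ`, so agreement on one period spreads to the line.
  have hd : Function.Periodic (fun x => hγ₁.closedRegular.arcCurvature x -
      hγ₂.closedRegular.arcCurvature (x + (m - a))) Λ := fun x => by
    simp only
    rw [hper, show x + Λ + (m - a) = x + (m - a) + Λ by ring, hper']
  obtain ⟨y, hy, hys⟩ := hd.exists_mem_Ico hΛ s a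
  rw [heq y hy, show y - a + m = y + (m - a) by ring, sub_self] at hys
  exact sub_eq_zero.1 hys

/-! ### Parameterizations of simple curves -/

namespace IsClosedRegular

variable {γ γ₁ γ₂ : ℝ → Plane}

lemma norm_arcTangent (h : IsClosedRegular γ) (s : ℝ) : ‖h.arcTangent s‖ = 1 :=
  h.norm_unitTangent _

lemma hasDerivAt_arcCurve_inner (h : IsClosedRegular γ) (u : Plane) (s : ℝ) :
    HasDerivAt (fun x => inner ℝ (h.arcCurve x) u) (inner ℝ (h.arcTangent s) u) s := by
  simpa using (h.hasDerivAt_arcCurve s).inner ℝ (hasDerivAt_const s u)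

lemma continuous_arcTangent_inner (h : IsClosedRegular γ) (u : Plane) :
    Continuous fun x => inner ℝ (h.arcTangent x) u :=
  h.continuous_arcTangent.inner continuous_const

lemma exists_arcTangent_inner_pos (h : IsClosedRegular γ) (s : ℝ) :
    ∃ ε > 0, ∀ x ∈ Ioo (s - ε) (s + ε), 0 < (inner ℝ (h.arcTangent x) (h.arcTangent s) : ℝ) := by
  have h0 : (0 : ℝ) < inner ℝ (h.arcTangent s) (h.arcTangent s) := by
    rw [real_inner_self_eq_norm_sq, h.norm_arcTangent]
    norm_num
  obtain ⟨ε, hε, hball⟩ := Metric.eventually_nhds_iff_ball.1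
    ((h.continuous_arcTangent_inner (h.arcTangent s)).continuousAt.eventually_const_lt h0)
  rw [Real.ball_eq_Ioo] at hball
  exact ⟨ε, hε, hball⟩

/-- Unit speed curves in `X` that pass through a simple point of `X` in the same direction coincide
nearby. -/
lemma eventually_arcCurve_eq (h₁ : IsClosedRegular γ₁) (h₂ : IsClosedRegular γ₂) {X : Set Plane}
    (hX₁ : ∀ x, h₁.arcCurve x ∈ X) (hX₂ : ∀ x, h₂.arcCurve x ∈ X) {s r : ℝ}
    (hp : IsSimplePoint X (h₁.arcCurve s)) (heq : h₁.arcCurve s = h₂.arcCurve r)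
    (hT : h₁.arcTangent s = h₂.arcTangent r) :
    ∀ᶠ x in 𝓝 r, h₁.arcCurve (s + (x - r)) = h₂.arcCurve x := by
  obtain ⟨ε, hε, hpos₁⟩ := h₁.exists_arcTangent_inner_pos s
  obtain ⟨η, hη, hpos₂⟩ := h₂.exists_arcTangent_inner_pos r
  rw [← hT] at hpos₂
  set u := h₁.arcTangent s
  -- The projection to the tangent direction `u` is strictly increasing near `s`.
  have hinj : InjOn h₁.arcCurve (Ioo (s - ε) (s + ε)) := by
    have hm : StrictMonoOn (fun x => (inner ℝ (h₁.arcCurve x) u : ℝ)) (Ioo (s - ε) (s + ε)) :=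
      strictMonoOn_of_hasDerivWithinAt_pos (convex_Ioo _ _)
        (fun x _ => (h₁.hasDerivAt_arcCurve_inner u x).continuousAt.continuousWithinAt)
        (fun x _ => (h₁.hasDerivAt_arcCurve_inner u x).hasDerivWithinAt)
        (fun x hx => hpos₁ x (interior_subset hx))
    intro x hx y hy hxy
    exact hm.injOn hx hy (congrArg (fun p => (inner ℝ p u : ℝ)) hxy)
  obtain ⟨h, δ, hδ, hc, hr, hspec⟩ := hp.exists_lift h₁.continuous_arcCurve h₂.continuous_arcCurve
    hX₁ hX₂ hε hinj heq
  have hm : 0 < min δ η := by positivity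
  have hsub : Ioo (r - min δ η) (r + min δ η) ⊆ Ioo (r - δ) (r + δ) :=
    Ioo_subset_Ioo (by linarith [min_le_left δ η]) (by linarith [min_le_left δ η])
  have hsub' : Ioo (r - min δ η) (r + min δ η) ⊆ Ioo (r - η) (r + η) :=
    Ioo_subset_Ioo (by linarith [min_le_right δ η]) (by linarith [min_le_right δ η])
  have hd : ∀ x ∈ Ioo (r - min δ η) (r + min δ η), x ≠ r → HasDerivAt h 1 x := by
    intro x hx _
    have hx' := hsub hx
    have hA := hpos₁ _ (hspec x hx').1
    have hB := hpos₂ x (hsub' hx)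
    have hev : ∀ᶠ y in 𝓝 x, h₁.arcCurve (h y) = h₂.arcCurve y := by
      filter_upwards [Ioo_mem_nhds hx'.1 hx'.2] with y hy using (hspec y hy).2
    have hstrict := hasStrictDerivAt_of_hasDerivAt_of_continuousAt
      (f := fun x => (inner ℝ (h₁.arcCurve x) u : ℝ))
      (.of_forall fun y => h₁.hasDerivAt_arcCurve_inner u y)
      (h₁.continuous_arcTangent_inner u).continuousAt (x := h x)
    have hdh := hstrict.hasDerivAt_of_comp_eventuallyEq hA.ne' (h₂.hasDerivAt_arcCurve_inner u x)
      ((hc x hx').continuousAt (Ioo_mem_nhds hx'.1 hx'.2))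
      (hev.mono fun y hy => congrArg (fun p => (inner ℝ p u : ℝ)) hy)
    -- The derivative of `h` is a quotient of two positive inner products, and it scales one unit
    -- tangent to another; so it is `1`.
    have hcomp := ((h₁.hasDerivAt_arcCurve (h x)).scomp x hdh).unique
      ((h₂.hasDerivAt_arcCurve x).congr_of_eventuallyEq hev)
    have hnorm := congrArg norm hcomp
    rw [norm_smul, h₁.norm_arcTangent, h₂.norm_arcTangent, mul_one, Real.norm_of_nonneg (by positivity)] at hnorm
    rwa [hnorm] at hdh
  filter_upwards [Ioo_mem_nhds (show r - min δ η < r by linarith) (show r < r + min δ η by linarith)]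
    with x hx
  rw [← hr, ← eq_add_of_hasDerivAt_one (hc.mono hsub) hd hx]
  exact (hspec x (hsub hx)).2

/-- The curvature is recovered from the Frenet equation by pairing the derivative of the tangent
with the unit normal. -/
lemma arcCurvature_eq_of_arcTangent_eq (h₁ : IsClosedRegular γ₁) (h₂ : IsClosedRegular γ₂) {τ : ℝ}
    (hT : ∀ s, h₁.arcTangent (s + τ) = h₂.arcTangent s) (s : ℝ) :
    h₁.arcCurvature (s + τ) = h₂.arcCurvature s := by
  have e0 := ((h₁.hasDerivAt_arcTangent_zero (s + τ)).comp_add_const s τ).unique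
    ((h₂.hasDerivAt_arcTangent_zero s).congr_of_eventuallyEq (.of_forall fun x => by
      simp only [hT]))
  have e1 := ((h₁.hasDerivAt_arcTangent_one (s + τ)).comp_add_const s τ).unique
    ((h₂.hasDerivAt_arcTangent_one s).congr_of_eventuallyEq (.of_forall fun x => by
      simp only [hT]))
  rw [hT] at e0 e1
  have := h₂.arcTangent_sq s
  linear_combination (-h₂.arcTangent s 1) * e0 + h₂.arcTangent s 0 * e1 -
    (h₁.arcCurvature (s + τ) - h₂.arcCurvature s) * this

lemma periodic_arcCurve (h : IsClosedRegular γ) {T : ℝ} (hT : Function.Periodic γ T) :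
    Function.Periodic h.arcCurve (h.arc T) := fun s => by
  rw [arcCurve, h.arc_symm_add_period hT, hT]
  rfl

/-- Regularity keeps `γ` from returning to `γ 0` at once, so positive periods are bounded away from
`0`. They form a closed set, whose infimum is attained. -/
lemma exists_isMinimalPeriod (h : IsClosedRegular γ) : ∃ L, IsMinimalPeriod γ L := by
  obtain ⟨T, hT0, hT⟩ := h.periodic
  obtain ⟨ε, hε, hball⟩ := Metric.eventually_nhds_iff_ball.1
    (eventually_nhdsWithin_iff.1 ((h.hasDerivAt 0).eventually_ne (c := γ 0) (h.regular 0)))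
  rw [Real.ball_eq_Ioo] at hball
  have hlow : ∀ P, 0 < P → Function.Periodic γ P → ε ≤ P := by
    intro P hP hper
    by_contra hlt
    exact hball P ⟨by linarith, by linarith⟩ hP.ne' (by simpa using hper 0)
  have hset : {P : ℝ | 0 < P ∧ Function.Periodic γ P} =
      {P : ℝ | ε ≤ P ∧ Function.Periodic γ P} := by
    ext P
    exact ⟨fun hP => ⟨hlow P hP.1 hP.2, hP.2⟩, fun hP => ⟨hε.trans_le hP.1, hP.2⟩⟩
  have hclosed : IsClosed {P : ℝ | ε ≤ P ∧ Function.Periodic γ P} := by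
    refine isClosed_Ici.inter ?_
    have : {P : ℝ | Function.Periodic γ P} = ⋂ x, {P | γ (x + P) = γ x} := by
      ext P
      simp [Function.Periodic]
    change IsClosed {P : ℝ | Function.Periodic γ P}
    rw [this]
    exact isClosed_iInter fun x => isClosed_eq
      (h.contDiff.continuous.comp (continuous_const.add continuous_id)) continuous_const
  unfold IsMinimalPeriod
  rw [hset]
  exact ⟨_, hclosed.isLeast_csInf ⟨T, hlow T hT0 hT, hT⟩ ⟨ε, fun P hP => hP.1⟩⟩

end IsClosedRegular

namespace OrientedClosedCurve

variable {Γ Γ₁ Γ₂ : OrientedClosedCurve} {γ γ₁ γ₂ : ℝ → Plane}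

/-- Two unit speed parameterizations of a simple curve differ by a translation. -/
lemma IsSimple.exists_translate (hΓ : Γ.IsSimple) (hγ₁ : Γ.IsParam γ₁) (hγ₂ : Γ.IsParam γ₂) :
    ∃ τ, ∀ s, hγ₁.closedRegular.arcCurve (s + τ) = hγ₂.closedRegular.arcCurve s ∧
      hγ₁.closedRegular.arcCurvature (s + τ) = hγ₂.closedRegular.arcCurvature s := by
  have h₁ := hγ₁.closedRegular
  have h₂ := hγ₂.closedRegular
  have hX₁ : ∀ x, h₁.arcCurve x ∈ Γ.carrier := fun x => hγ₁.range_eq ▸ mem_range_self _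
  have hX₂ : ∀ x, h₂.arcCurve x ∈ Γ.carrier := fun x => hγ₂.range_eq ▸ mem_range_self _
  -- The common orientation supplies a parameter at which `γ₁` passes through `γ₂ 0` in the same
  -- direction; this fixes the translation.
  have hmem : (γ₂ 0, unitTangent γ₂ 0) ∈ inducedOrientation γ₁ := by
    rw [hγ₁.orientation_eq, ← hγ₂.orientation_eq]
    refine ⟨?_, 0, rfl, rfl⟩
    rw [hγ₂.range_eq]
    exact hΓ _ (hγ₂.range_eq ▸ mem_range_self _)
  obtain ⟨-, t, ht, htu⟩ := hmem
  set τ := h₁.arc t with hτ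
  set E : Set ℝ := {x | h₁.arcCurve (x + τ) = h₂.arcCurve x ∧
    h₁.arcTangent (x + τ) = h₂.arcTangent x} with hE
  have hadd : Continuous fun x : ℝ => x + τ := continuous_id.add continuous_const
  have hclosed : IsClosed E :=
    (isClosed_eq (h₁.continuous_arcCurve.comp hadd) h₂.continuous_arcCurve).inter
      (isClosed_eq (h₁.continuous_arcTangent.comp hadd) h₂.continuous_arcTangent)
  -- All points being simple, local coincidence holds at each point of `E`, and tangents then agree
  -- by differentiation.
  have hopen : IsOpen E := by
    rw [isOpen_iff_mem_nhds]
    intro r hr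
    have hev := h₁.eventually_arcCurve_eq h₂ hX₁ hX₂ (hΓ _ (hX₁ _)) hr.1 hr.2
    filter_upwards [hev.eventually_nhds] with x hx
    have hx' : ∀ᶠ y in 𝓝 x, h₁.arcCurve (y + τ) = h₂.arcCurve y := by
      filter_upwards [hx] with y hy
      rwa [show r + τ + (y - r) = y + τ by ring] at hy
    exact ⟨hx'.self_of_nhds, ((h₁.hasDerivAt_arcCurve (x + τ)).comp_add_const x τ).unique
      ((h₂.hasDerivAt_arcCurve x).congr_of_eventuallyEq hx')⟩
  have h0 : (0 : ℝ) ∈ E := by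
    have e : h₂.arc 0 = 0 := h₂.arc_zero
    have e1 := h₂.arcCurve_arc 0
    have e2 := h₂.arcTangent_arc 0
    rw [e] at e1 e2
    refine ⟨?_, ?_⟩
    · rw [zero_add, hτ, h₁.arcCurve_arc, e1]; exact ht
    · rw [zero_add, hτ, h₁.arcTangent_arc, e2]; exact htu
  have huniv : E = univ := IsClopen.eq_univ ⟨hclosed, hopen⟩ ⟨0, h0⟩
  have hall : ∀ s, s ∈ E := fun s => huniv ▸ mem_univ s
  exact ⟨τ, fun s => ⟨(hall s).1,
    h₁.arcCurvature_eq_of_arcTangent_eq h₂ (fun s => (hall s).2) s⟩⟩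

/-- The signature of a simple curve is the image of any of its signature maps. -/
lemma IsSimple.signature_eq_range (hΓ : Γ.IsSimple) (hγ : Γ.IsParam γ) :
    Γ.signature = range (sigMap γ) := by
  ext z
  constructor
  · rintro ⟨γ', hγ', t, rfl⟩
    obtain ⟨τ, hτ⟩ := hΓ.exists_translate hγ hγ'
    rw [← hγ'.closedRegular.phase_arcCurvature_arc, ← phase_translate (fun s => (hτ s).2),
      hγ.closedRegular.phase_arcCurvature]
    exact mem_range_self _
  · rintro ⟨t, rfl⟩
    exact ⟨γ, hγ, t, rfl⟩

end OrientedClosedCurve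

/-! ### Edges of the signature quiver -/

lemma InducesPath.congr {S : Set (ℝ × ℝ)} {γ γ' : ℝ → Plane} (hσ : sigMap γ' = sigMap γ)
    (hL : ∀ L, IsMinimalPeriod γ' L ↔ IsMinimalPeriod γ L) {p : QuiverVertex S}
    {W : Quiver.Path p p} : InducesPath γ' W ↔ InducesPath γ W := by
  simp only [InducesPath, hσ, hL]

/-- Comparing `f` with itself by `phase_eq_on_arc`: parameters with equal phase points are equally
far from `a`. -/
lemma HasIsolatedCriticalPoints.injOn_phase_arc {S : Set (ℝ × ℝ)} {f : ℝ → ℝ}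
    (hf : HasIsolatedCriticalPoints f) (hfS : ∀ x, phase f x ∈ S) {a b : ℝ}
    (hn : ∀ x ∈ Ioo a b, phase f x ∉ selfIntersections S)
    (ha : phase f a ∈ selfIntersections S) (hb : phase f b ∈ selfIntersections S) :
    InjOn (phase f) (Ioo a b) := fun s hs r hr heq => by
  have := (hf.phase_eq_on_arc hf hfS hfS hs hr hn hn ha hb ha hb heq).1
  linarith

/-- An arc of the signature between consecutive points of self-intersection is an edge. -/
lemma HasIsolatedCriticalPoints.exists_edge {S : Set (ℝ × ℝ)} {f : ℝ → ℝ}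
    (hf : HasIsolatedCriticalPoints f) (hfS : ∀ x, phase f x ∈ S) {a b : ℝ} (hab : a < b)
    (hn : ∀ x ∈ Ioo a b, phase f x ∉ selfIntersections S) {p q : QuiverVertex S}
    (ha : p.1 = phase f a) (hb : q.1 = phase f b) :
    ∃ e : QuiverEdge S p q, e.segment = phase f '' Ioo a b := by
  have haQ : phase f a ∈ selfIntersections S := ha ▸ p.2
  have hbQ : phase f b ∈ selfIntersections S := hb ▸ q.2
  set M := phase f '' Ioo a b with hM
  have hinj := hf.injOn_phase_arc hfS hn haQ hbQ
  obtain ⟨z, hz⟩ : M.Nonempty := (nonempty_Ioo.2 hab).image _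
  have hMS : M ⊆ S \ selfIntersections S := by
    rintro _ ⟨x, hx, rfl⟩
    exact ⟨hfS x, hn x hx⟩
  have hMpre : IsPreconnected M := isPreconnected_Ioo.image _ hf.continuous_phase.continuousOn
  refine ⟨⟨M, ⟨z, hMS hz, (hMpre.subset_connectedComponentIn hz hMS).antisymm ?_⟩, f, a, b,
    hf.contDiff, hab, hinj, rfl, ha.symm, hb.symm⟩, rfl⟩
  set K := phase f '' Icc a b with hK
  have hKclosed : IsClosed K := (isCompact_Icc.image hf.continuous_phase).isClosed
  -- The compact arc `K` adds only self-intersections to `M`, so `M` is closed in `S` minus its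
  -- self-intersections.
  have hKM : ∀ w ∈ K, w ∉ selfIntersections S → w ∈ M := by
    rintro _ ⟨x, hx, rfl⟩ hxQ
    refine mem_image_of_mem _ ⟨lt_of_le_of_ne hx.1 ?_, lt_of_le_of_ne hx.2 ?_⟩
    · rintro rfl; exact hxQ haQ
    · rintro rfl; exact hxQ hbQ
  -- By the covering property at simple points, `M` is also open in `S`; hence a connected set in
  -- the complement of the self-intersections that meets `M` stays in it.
  have hnhds : ∀ w ∈ M, ∃ U, IsOpen U ∧ w ∈ U ∧ U ∩ S ⊆ M := by
    rintro _ ⟨x, hx, rfl⟩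
    have hp : IsSimplePoint S (phase f x) := by
      by_contra h
      exact hn x hx ⟨hfS x, h⟩
    obtain ⟨ε, hε, hball⟩ := Metric.isOpen_iff.1 (isOpen_Ioo (a := a) (b := b)) x hx
    rw [Real.ball_eq_Ioo] at hball
    obtain ⟨U, hU, hxU, hUS⟩ := mem_nhdsWithin.1
      (hp.image_Ioo_mem_nhdsWithin hf.continuous_phase hfS hε (hinj.mono hball))
    exact ⟨U, hU, hxU, hUS.trans (image_mono hball)⟩
  choose! U hU hwU hUS using hnhds
  have hO : IsOpen (⋃ w ∈ M, U w) := isOpen_biUnion fun w hw => hU w hw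
  have hC := isPreconnected_connectedComponentIn (x := z) (F := S \ selfIntersections S)
  have hCsub := connectedComponentIn_subset (S \ selfIntersections S) z
  have hzC := mem_connectedComponentIn (hMS hz)
  intro w hw
  by_contra hwM
  have hwK : w ∈ Kᶜ := fun h => hwM (hKM w h (hCsub hw).2)
  obtain ⟨y, hyC, hyO, hyK⟩ := hC (⋃ w ∈ M, U w) Kᶜ hO hKclosed.isOpen_compl
    (fun y hy => by
      by_cases hyK : y ∈ K
      · exact Or.inl (mem_biUnion (hKM y hyK (hCsub hy).2) (hwU y (hKM y hyK (hCsub hy).2)))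
      · exact Or.inr hyK)
    ⟨z, hzC, mem_biUnion hz (hwU z hz)⟩ ⟨w, hw, hwK⟩
  obtain ⟨m, hm, hym⟩ := mem_iUnion₂.1 hyO
  exact hyK (image_mono Ioo_subset_Icc_self (hUS m hm ⟨hym, (hCsub hyC).1⟩))

/-- The phase curve is locally injective, so it meets a finite set locally at finitely many
parameters; compactness does the rest. -/
lemma HasIsolatedCriticalPoints.finite_preimage {f : ℝ → ℝ} (hf : HasIsolatedCriticalPoints f)
    {Q : Set (ℝ × ℝ)} (hQ : Q.Finite) (a b : ℝ) : (Icc a b ∩ phase f ⁻¹' Q).Finite := by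
  refine isCompact_Icc.induction_on (p := fun s => (s ∩ phase f ⁻¹' Q).Finite) (by simp)
    (fun s t hst ht => ht.subset (inter_subset_inter_left _ hst))
    (fun s t hs ht => by rw [union_inter_distrib_right]; exact hs.union ht) fun x _ => ?_
  obtain ⟨ε, hε, hinj⟩ := hf.exists_injOn_phase x
  refine ⟨_, nhdsWithin_le_nhds (Ioo_mem_nhds (show x - ε < x by linarith)
    (show x < x + ε by linarith)), ?_⟩
  refine (hQ.subset (image_subset_iff.2 fun y hy => hy.2)).of_finite_image
    (f := phase f) (hinj.mono inter_subset_left)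

lemma Set.Finite.exists_knots {K : Set ℝ} (hK : K.Finite) {a b : ℝ} (hKab : K ⊆ Icc a b)
    (ha : a ∈ K) (hb : b ∈ K) :
    ∃ (k : ℕ) (c : Fin (k + 1) → ℝ), StrictMono c ∧ range c = K ∧ c 0 = a ∧ c (Fin.last k) = b := by
  obtain ⟨k, hk⟩ : ∃ k, hK.toFinset.card = k + 1 :=
    Nat.exists_eq_succ_of_ne_zero (Finset.card_ne_zero.2 ⟨a, hK.mem_toFinset.2 ha⟩)
  set c := hK.toFinset.orderEmbOfFin hk
  have hr : range c = K := by simp [c]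
  have hmono : StrictMono c := c.strictMono
  refine ⟨k, c, hmono, hr, le_antisymm ?_ ?_, le_antisymm ?_ ?_⟩
  · obtain ⟨i, hi⟩ := hr.symm.subset ha
    rw [← hi]; exact hmono.monotone (Fin.zero_le i)
  · exact (hKab (hr.subset (mem_range_self _))).1
  · exact (hKab (hr.subset (mem_range_self _))).2
  · obtain ⟨i, hi⟩ := hr.symm.subset hb
    rw [← hi]; exact hmono.monotone (Fin.le_last i)

lemma exists_path_of_edges {S : Set (ℝ × ℝ)} {σ : ℝ → ℝ × ℝ} {k : ℕ} (c : Fin (k + 1) → ℝ)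
    (hQ : ∀ i, σ (c i) ∈ selfIntersections S)
    (he : ∀ (i : Fin k) (p q : QuiverVertex S), p.1 = σ (c i.castSucc) → q.1 = σ (c i.succ) →
      ∃ e : QuiverEdge S p q, e.segment = σ '' Ioo (c i.castSucc) (c i.succ))
    (p q : QuiverVertex S) (hp : p.1 = σ (c 0)) (hq : q.1 = σ (c (Fin.last k))) :
    ∃ W : Quiver.Path p q,
      pathSegments W = List.ofFn fun i : Fin k => σ '' Ioo (c i.castSucc) (c i.succ) := by
  induction k generalizing q with
  | zero =>
    obtain rfl : p = q := Subtype.ext (hp.trans hq.symm)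
    exact ⟨Quiver.Path.nil, by simp [pathSegments]⟩
  | succ k ih =>
    obtain ⟨W, hW⟩ := ih (fun i => c i.castSucc) (fun i => hQ _) (fun i => he i.castSucc)
      ⟨σ (c (Fin.last k).castSucc), hQ _⟩ hp rfl
    obtain ⟨e, hes⟩ := he (Fin.last k) ⟨σ (c (Fin.last k).castSucc), hQ _⟩ q rfl hq
    refine ⟨W.cons e, ?_⟩
    change pathSegments W ++ [e.segment] = _
    rw [List.ofFn_succ', List.concat_eq_append, hW, hes]
    rfl

namespace OrientedClosedCurve

variable {Γ Γ₁ Γ₂ : OrientedClosedCurve} {γ γ₁ γ₂ : ℝ → Plane}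

/-- Every parameterization of a simple curve induces a closed path. -/
lemma IsSimple.exists_inducesPath (hΓ : Γ.IsSimple) (hnd : Γ.NonDegenerate) {S : Set (ℝ × ℝ)}
    (hS : Γ.signature = S) (hne : (selfIntersections S).Nonempty)
    (hfin : (selfIntersections S).Finite) (hγ : Γ.IsParam γ) :
    ∃ (p : QuiverVertex S) (W : Quiver.Path p p), InducesPath γ W := by
  have h := hγ.closedRegular
  have hf : HasIsolatedCriticalPoints h.arcCurvature := hγ.hasIsolatedCriticalPoints hnd
  have hfS : ∀ x, phase h.arcCurvature x ∈ S := fun x => hS ▸ hγ.phase_mem_signature x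
  obtain ⟨L, hL⟩ := h.exists_isMinimalPeriod
  obtain ⟨z, hz⟩ := hne
  -- Simplicity ensures that this particular `γ` reaches the self-intersection `z`; it provides the
  -- starting parameter.
  obtain ⟨t, rfl⟩ : z ∈ range (sigMap γ) := by
    rw [← hΓ.signature_eq_range hγ, hS]; exact hz.1
  have hper := IsClosedRegular.periodic_sigMap hL.1.2
  have hσ : phase h.arcCurvature ∘ h.arc = sigMap γ := funext h.phase_arcCurvature_arc
  have hK : (Icc t (t + L) ∩ sigMap γ ⁻¹' selfIntersections S).Finite := by
    refine ((hf.finite_preimage hfin (h.arc t) (h.arc (t + L))).subset ?_).of_finite_image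
      (f := h.arc) h.arc.injective.injOn
    rintro _ ⟨x, hx, rfl⟩
    refine ⟨⟨h.arc.monotone hx.1.1, h.arc.monotone hx.1.2⟩, ?_⟩
    rw [mem_preimage, h.phase_arcCurvature_arc]
    exact hx.2
  have hle : t ≤ t + L := by linarith [hL.1.1]
  obtain ⟨k, c, hc, hr, h0, hlast⟩ := hK.exists_knots inter_subset_left
    ⟨left_mem_Icc.2 hle, hz⟩ ⟨right_mem_Icc.2 hle, by rw [mem_preimage, hper]; exact hz⟩
  have hQ : ∀ i, sigMap γ (c i) ∈ selfIntersections S := fun i => (hr.subset (mem_range_self i)).2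
  have hr' : range c = Icc (c 0) (c (Fin.last k)) ∩ sigMap γ ⁻¹' selfIntersections S := by
    rw [hr, h0, hlast]
  obtain ⟨W, hW⟩ := exists_path_of_edges c hQ (fun i p q hp hq => by
    have himg : sigMap γ '' Ioo (c i.castSucc) (c i.succ) =
        phase h.arcCurvature '' Ioo (h.arc (c i.castSucc)) (h.arc (c i.succ)) := by
      rw [← h.arc.image_Ioo, ← image_comp, hσ]
    rw [himg]
    refine hf.exists_edge hfS (h.arc.strictMono (hc i.castSucc_lt_succ)) ?_
      (by rw [h.phase_arcCurvature_arc]; exact hp) (by rw [h.phase_arcCurvature_arc]; exact hq)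
    rw [← h.arc.image_Ioo]
    rintro _ ⟨x, hx, rfl⟩
    rw [h.phase_arcCurvature_arc]
    exact hc.notMem_of_range_eq hr' i hx) ⟨sigMap γ t, hz⟩ ⟨sigMap γ t, hz⟩ (by rw [h0])
    (by rw [hlast, hper])
  exact ⟨_, W, L, k, c, hL, hc, by rw [hlast, h0], by rw [hr, h0], by rw [h0], hW⟩

/-- Parameterizations that run once through a simple curve induce the same closed paths. -/
lemma IsSimple.inducesPath_of_traversesOnce (hΓ : Γ.IsSimple) (hγ₁ : Γ.IsParam γ₁)
    (hγ₂ : Γ.IsParam γ₂) (ht₁ : TraversesOnce γ₁) (ht₂ : TraversesOnce γ₂) {S : Set (ℝ × ℝ)}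
    {p : QuiverVertex S} {W : Quiver.Path p p} (hW : InducesPath γ₂ W) : InducesPath γ₁ W := by
  have h₁ := hγ₁.closedRegular
  have h₂ := hγ₂.closedRegular
  obtain ⟨τ, hτ⟩ : ∃ τ, ∀ s, h₁.arcCurve (s + τ) = h₂.arcCurve s ∧
      h₁.arcCurvature (s + τ) = h₂.arcCurvature s := hΓ.exists_translate hγ₁ hγ₂
  obtain ⟨L₁, hL₁, hi₁⟩ := ht₁
  obtain ⟨L₂, hL₂, hi₂⟩ := ht₂
  have hinj : ∀ {γ : ℝ → Plane} {L : ℝ} (h : IsClosedRegular γ), InjOn γ (Ico 0 L) →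
      InjOn h.arcCurve (Ico 0 (h.arc L)) := by
    intro γ L h hi
    have hm : MapsTo h.arc.symm (Ico 0 (h.arc L)) (Ico 0 L) := fun x hx => by
      refine ⟨?_, h.arc.symm_apply_lt.2 hx.2⟩
      rw [h.arc.le_symm_apply, h.arc_zero]
      exact hx.1
    exact hi.comp h.arc.symm.injective.injOn hm
  have hpos : ∀ {γ : ℝ → Plane} {L : ℝ} (h : IsClosedRegular γ), 0 < L → 0 < h.arc L :=
    fun h hL => by rw [← h.arc_zero]; exact h.arc.strictMono hL
  have hp₁ := h₁.periodic_arcCurve hL₁.1.2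
  have hp₂ := h₂.periodic_arcCurve hL₂.1.2
  have hΛ₁ := hpos h₁ hL₁.1.1
  have hΛ₂ := hpos h₂ hL₂.1.1
  -- A minimal period may run through a curve several times at varying speeds, so its length need
  -- not be intrinsic. Here, by the translation, the length of either period is a period of the
  -- other unit speed curve, and injectivity forbids returning early.
  have hΛ : h₂.arc L₂ = h₁.arc L₁ := by
    rcases lt_trichotomy (h₂.arc L₂) (h₁.arc L₁) with hlt | heq | hlt
    · refine absurd (hinj h₁ hi₁ ⟨hΛ₂.le, hlt⟩ ⟨le_rfl, hΛ₁⟩ ?_) hΛ₂.ne'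
      rw [← sub_add_cancel (h₂.arc L₂) τ, ← sub_add_cancel 0 τ, (hτ _).1, (hτ _).1, zero_sub,
        sub_eq_neg_add, hp₂]
    · exact heq
    · refine absurd (hinj h₂ hi₂ ⟨hΛ₁.le, hlt⟩ ⟨le_rfl, hΛ₂⟩ ?_) hΛ₁.ne'
      rw [← (hτ _).1, ← (hτ _).1, zero_add, add_comm, hp₁]
  -- The change of parameter from `γ₂` to `γ₁` through arc length; it carries the knots of `W` over.
  set ψ : ℝ ≃o ℝ := (h₂.arc.trans (OrderIso.addRight τ)).trans h₁.arc.symm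
  have hψσ : ∀ t, sigMap γ₁ (ψ t) = sigMap γ₂ t := fun t => by
    rw [← h₂.phase_arcCurvature_arc, ← phase_translate fun s => (hτ s).2,
      h₁.phase_arcCurvature]
    rfl
  have hψL : ∀ t, ψ (t + L₂) = ψ t + L₁ := fun t => by
    change h₁.arc.symm (h₂.arc (t + L₂) + τ) = h₁.arc.symm (h₂.arc t + τ) + L₁
    rw [h₂.arc_add_period hL₂.1.2, hΛ, add_right_comm, h₁.arc_symm_add_period hL₁.1.2]
  have hcomp : sigMap γ₁ ∘ ψ = sigMap γ₂ := funext hψσ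
  obtain ⟨L, k, c, hL, hc, hlast, hr, hp, hseg⟩ := hW
  obtain rfl : L₂ = L := hL₂.unique hL
  refine ⟨L₁, k, ψ ∘ c, hL₁, ψ.strictMono.comp hc, ?_, ?_, ?_, ?_⟩
  · rw [Function.comp_apply, Function.comp_apply, hlast, hψL]
  · rw [range_comp, hr, Function.comp_apply, ← hψL, ← ψ.image_Icc, ← hcomp, preimage_comp,
      image_inter_preimage]
  · rw [Function.comp_apply, hψσ, hp]
  · rw [hseg]
    congr 1
    funext i
    rw [Function.comp_apply, Function.comp_apply, ← ψ.image_Ioo, ← image_comp, hcomp]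

/-- A congruence carries parameterizations to parameterizations. -/
lemma Congruent.exists_param (hcong : Γ₁.Congruent Γ₂) (hγ : Γ₁.IsParam γ) :
    ∃ γ', Γ₂.IsParam γ' ∧ sigMap γ' = sigMap γ ∧
      (∀ L, IsMinimalPeriod γ' L ↔ IsMinimalPeriod γ L) ∧
      ∀ s, InjOn γ s → InjOn γ' s := by
  obtain ⟨A, hA, v, hcar, hor⟩ := hcong
  obtain ⟨e, he⟩ := exists_homeomorph_rigid hA v
  obtain ⟨a1, a2, a3⟩ := specialOrthogonalGroup_entries hA
  have h := hγ.closedRegular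
  set B : Plane →L[ℝ] Plane := LinearMap.toContinuousLinearMap (Matrix.toEuclideanLin A) with hB
  have hBe : ∀ p, e p = B p + v := he
  have hBi : ∀ p i, B p i = A i 0 * p 0 + A i 1 * p 1 := toEuclideanLin_plane A
  have hnorm : ∀ p, ‖B p‖ = ‖p‖ := fun p => by
    rw [← sq_eq_sq₀ (norm_nonneg _) (norm_nonneg _), plane_norm_sq, plane_norm_sq, hBi, hBi, a1, a2]
    linear_combination (p 0 ^ 2 + p 1 ^ 2) * a3
  have hdet : ∀ p q, planeDet (B p) (B q) = planeDet p q := fun p q => by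
    simp only [planeDet, hBi, a1, a2]
    linear_combination (p 0 * q 1 - p 1 * q 0) * a3
  set γ' : ℝ → Plane := fun t => e (γ t) with hγ'
  have hd : deriv γ' = fun t => B (deriv γ t) := funext fun t => by
    have := (B.hasFDerivAt.comp_hasDerivAt t (h.hasDerivAt t)).add_const v
    exact (this.congr_of_eventuallyEq (.of_forall fun x => hBe _)).deriv
  have hdd : deriv (deriv γ') = fun t => B (deriv (deriv γ) t) := by
    rw [hd]
    exact funext fun t => (B.hasFDerivAt.comp_hasDerivAt t (h.hasDerivAt_deriv t)).deriv
  have hκ : curvature γ' = curvature γ := funext fun t => by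
    rw [curvature, curvature, hdd, hd, hdet, hnorm]
  have hσ : sigMap γ' = sigMap γ := funext fun t => by
    rw [sigMap, sigMap, curvatureDot, curvatureDot, hκ, hd, hnorm]
  have hper : ∀ T, Function.Periodic γ' T ↔ Function.Periodic γ T := fun T =>
    forall_congr' fun x => e.injective.eq_iff
  have htan : ∀ t, γ' t = e (γ t) ∧ unitTangent γ' t = B (unitTangent γ t) := fun t =>
    ⟨rfl, by rw [unitTangent, unitTangent, hd, hnorm, map_smul]⟩
  obtain ⟨hr, ho⟩ := inducedOrientation_eq_image e B (fun t => ⟨t, htan t⟩) (fun t => ⟨t, htan t⟩)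
  refine ⟨γ', ⟨⟨?_, fun t => ?_, ?_⟩, ?_, ?_⟩, hσ, fun L => ?_, fun s hs => ?_⟩
  · have : γ' = fun t => B (γ t) + v := funext fun t => hBe _
    rw [this]
    exact (B.contDiff.comp h.contDiff).add contDiff_const
  · rw [hd]
    exact norm_pos_iff.1 (by simpa only [hnorm] using h.speed_pos t)
  · obtain ⟨T, hT0, hT⟩ := h.periodic
    exact ⟨T, hT0, (hper T).2 hT⟩
  · rw [hr, hcar, hγ.range_eq]
    exact image_congr fun p _ => he p
  · rw [ho, hor, hγ.orientation_eq]
    exact image_congr fun x _ => Prod.ext (he x.1) rfl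
  · simp only [IsMinimalPeriod, hper]
  · exact e.injective.injOn.comp hs (mapsTo_univ _ _)

end OrientedClosedCurve

lemma InduceEquivalentPaths.of_same {S : Set (ℝ × ℝ)} {γ₁ γ₂ : ℝ → Plane} {p : QuiverVertex S}
    {W : Quiver.Path p p} (h₁ : InducesPath γ₁ W) (h₂ : InducesPath γ₂ W) :
    InduceEquivalentPaths S γ₁ γ₂ :=
  ⟨p, p, W, W, h₁, h₂, Quiver.Path.nil, W, (Quiver.Path.nil_comp W).symm, rfl⟩

/-! ### Assembly of both directions. -/

theorem mainTheorem1 (Γ₁ Γ₂ : OrientedClosedCurve) (S : Set (ℝ × ℝ))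
    (hΓ₁ : Γ₁.NonDegenerate) (hΓ₂ : Γ₂.NonDegenerate)
    (hS₁ : Γ₁.signature = S) (hS₂ : Γ₂.signature = S)
    (hne : (selfIntersections S).Nonempty) (hfin : (selfIntersections S).Finite) :
    ((∃ γ₁ γ₂, Γ₁.IsParam γ₁ ∧ Γ₂.IsParam γ₂ ∧ InduceEquivalentPaths S γ₁ γ₂) →
      Γ₁.Congruent Γ₂) ∧
    (Γ₁.IsSimple → Γ₂.IsSimple → Γ₁.Congruent Γ₂ →
      (∃ γ₁ γ₂, Γ₁.IsParam γ₁ ∧ Γ₂.IsParam γ₂ ∧ InduceEquivalentPaths S γ₁ γ₂) ∧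
      (∀ γ₁ γ₂, Γ₁.IsParam γ₁ → Γ₂.IsParam γ₂ → TraversesOnce γ₁ → TraversesOnce γ₂ →
        InduceEquivalentPaths S γ₁ γ₂)) := by
  refine ⟨fun ⟨γ₁, γ₂, hγ₁, hγ₂, h⟩ =>
    OrientedClosedCurve.congruent_of_induceEquivalentPaths hΓ₁ hΓ₂ hS₁ hS₂ hγ₁ hγ₂ h,
    fun hs₁ hs₂ hcong => ⟨?_, fun γ₁ γ₂ hγ₁ hγ₂ ht₁ ht₂ => ?_⟩⟩
  · obtain ⟨γ₁, h, hr, ho⟩ := Γ₁.exists_param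
    have hγ₁ : Γ₁.IsParam γ₁ := ⟨h, hr, ho⟩
    obtain ⟨p, W, hW⟩ := hs₁.exists_inducesPath hΓ₁ hS₁ hne hfin hγ₁
    -- The moved parameterization has the same signature map and minimal period, hence induces the
    -- very same path.
    obtain ⟨γ₂, hγ₂, hσ, hL, -⟩ := hcong.exists_param hγ₁
    exact ⟨γ₁, γ₂, hγ₁, hγ₂, .of_same hW ((InducesPath.congr hσ hL).2 hW)⟩
  -- A path of `γ₂` passes to the image `γ'` of `γ₁` under the congruence, as both run once through
  -- `Γ₂`, and then back to `γ₁`.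
  · obtain ⟨p, W, hW⟩ := hs₂.exists_inducesPath hΓ₂ hS₂ hne hfin hγ₂
    obtain ⟨γ', hγ', hσ, hL, hinj⟩ := hcong.exists_param hγ₁
    obtain ⟨L, hLmin, hLinj⟩ := ht₁
    have ht' : TraversesOnce γ' := ⟨L, (hL L).2 hLmin, hinj _ hLinj⟩
    exact .of_same ((InducesPath.congr hσ hL).1
      (hs₂.inducesPath_of_traversesOnce hγ' hγ₂ ht' ht₂ hW)) hW
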